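/- Let $n\ge 2$ be an integer, let $e_z\in\mathbb R^3$ be a unit vector, let $\mathbb S^2$ be the unit sphere of $\mathbb R^3$, and for $u\in\mathbb R^3$ let $S(u)$ be the $3\times 3$ skew-symmetric matrix with $S(u)w=u\times w$. Put $$\Upsilon_n=\mathbb R^{3n}\times\{z\in\mathbb R^3: e_z-z\in\mathbb S^2\},\qquad \Upsilon_n^*=\mathbb R^{3n}\times\big(\{z\in\mathbb R^3: e_z-z\in\mathbb S^2\}\setminus\{2e_z\}\big).$$ Call gains $(\alpha_1,\dots,\alpha_n,\gamma)$ admissible if $\alpha_1,\dots,\alpha_n,\gamma>0$ and the polynomial $s^n+\alpha_ns^{n-1}+\dots+\alpha_2s+\alpha_1$ is Hurwitz (all its complex roots have negative real part). For admissible gains consider the autonomous ODE for $\xi=(z_{p_1},\dots,z_{p_n},z_2)$, $$\dot z_{p_i}=z_{p_{i+1}}\ (1\le i\le n-1),\qquad \dot z_{p_n}=-\sum_{i=1}^n\alpha_i z_{p_i},\qquad \dot z_2=\gamma\,S(e_z-z_2)^2\,(z_2-z_{p_1}).\tag{$*$}$$ 1. For all admissible gains, the state space of $(*)$ is $\Upsilon_n$: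 from every point of $\Upsilon_n$ there starts a unique solution, it is defined for all $t\ge 0$ and it stays in $\Upsilon_n$. On $\Upsilon_n$ the system has exactly two equilibrium points, $(0,0)$ and $(0,2e_z)$, where the first $0$ is in $\mathbb R^{3n}$, and every trajectory in $\Upsilon_n$ converges, as $t\to+\infty$, to one of the two. 2. For all admissible gains, $(*)$ on $\Upsilon_n$ is almost globally asymptotically stable with respect to the origin $(0,0)$, that is, the origin is Lyapunov stable and there is an open and dense subset of $\Upsilon_n$ such that every trajectory starting in it converges to the origin. Moreover the origin is locally exponentially stable: there are $r,C,\lambda>0$ such that $\|\xi(t)\|\le C\|\xi(0)\|e^{-\lambda t}$ for all $t\ge0$ and every trajectory in $\Upsilon_n$ with $\|\xi(0)\|<r$. 3. For every compact set $K\subset\Upsilon_n^*$ and every $\varrho>0$ there exist admissible gains $(\alpha_1,\dots,\alpha_n,\gamma)$ such that the trajectories of $(*)$ starting in $K$ converge exponentially to the origin with exponential rate at least $\varrho$: there is $C>0$ with $\|\xi(t)\|\le C\|\xi(0)\|e^{-\varrho t}$ for all $t\ge0$ and every trajectory with $\xi(0)\in K$. -/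

import Mathlib

open Set Filter Topology

namespace TiltObserver

/-! ### Dynamical systems on a subset of a normed space -/

section Dynamics

variable {E : Type*} [NormedAddCommGroup E] [NormedSpace ℝ E]

/-- A (forward, global) trajectory of `ẋ = f x` in the state space `X`: a solution on `[0, ∞)`
with values in `X`; at `t = 0` the derivative is the right derivative. -/
def IsTrajectory (f : E → E) (X : Set E) (ξ : ℝ → E) : Prop :=
  ∀ t : ℝ, 0 ≤ t → ξ t ∈ X ∧ HasDerivWithinAt ξ (f (ξ t)) (Ici 0) t

/-- `X` is a state space for `ẋ = f x`: from every point of `X` there starts a trajectory that is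
defined for all `t ≥ 0` and stays in `X`, and every solution in the ambient space from that point,
on any interval `[0, T)`, coincides with it. -/
def IsStateSpace (f : E → E) (X : Set E) : Prop :=
  ∀ x ∈ X, ∃ ξ : ℝ → E, IsTrajectory f X ξ ∧ ξ 0 = x ∧
    ∀ T : ℝ, 0 < T → ∀ η : ℝ → E, η 0 = x →
      (∀ t ∈ Ico 0 T, HasDerivWithinAt η (f (η t)) (Ico 0 T) t) → EqOn η ξ (Ico 0 T)

/-- Lyapunov (local) stability of the point `x₀` for `ẋ = f x` on `X`. -/
def IsLyapunovStable (f : E → E) (X : Set E) (x₀ : E) : Prop :=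
  ∀ ε : ℝ, 0 < ε → ∃ δ : ℝ, 0 < δ ∧ ∀ ξ : ℝ → E, IsTrajectory f X ξ → ‖ξ 0 - x₀‖ < δ →
    ∀ t : ℝ, 0 ≤ t → ‖ξ t - x₀‖ < ε

/-- Almost global asymptotic stability with respect to the equilibrium `x₀`: `x₀` is Lyapunov
stable, and there is an open and dense subset `X₁` of the space `X` such that every trajectory
starting in `X₁` converges to `x₀`. -/
def IsAlmostGloballyAsymptoticallyStable (f : E → E) (X : Set E) (x₀ : E) : Prop :=
  x₀ ∈ X ∧ f x₀ = 0 ∧ IsLyapunovStable f X x₀ ∧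
    ∃ X₁ : Set X, IsOpen X₁ ∧ Dense X₁ ∧
      ∀ ξ : ℝ → E, IsTrajectory f X ξ → ξ 0 ∈ (Subtype.val '' X₁ : Set E) →
        Tendsto ξ atTop (𝓝 x₀)

/-- The trajectories in `X` starting in `K` converge exponentially to `x₀`, with exponential rate
at least `ρ`, uniformly on `K`. -/
def ConvergesExponentiallyFrom (f : E → E) (X K : Set E) (x₀ : E) (ρ : ℝ) : Prop :=
  ∃ C : ℝ, 0 < C ∧ ∀ ξ : ℝ → E, IsTrajectory f X ξ → ξ 0 ∈ K →
    ∀ t : ℝ, 0 ≤ t → ‖ξ t - x₀‖ ≤ C * ‖ξ 0 - x₀‖ * Real.exp (-ρ * t)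

/-- Local exponential stability of `x₀`. -/
def IsLocallyExponentiallyStable (f : E → E) (X : Set E) (x₀ : E) : Prop :=
  ∃ r : ℝ, 0 < r ∧ ∃ ρ : ℝ, 0 < ρ ∧ ConvergesExponentiallyFrom f X (Metric.ball x₀ r) x₀ ρ

end Dynamics

/-! ### The error dynamics of the two-step observer of order `n` -/

/-- Euclidean three-space. -/
abbrev E3 : Type := EuclideanSpace ℝ (Fin 3)

/-- The ambient space `ℝ^{3n} × ℝ³`, with points `(ψ, z₂)`, `ψ i` standing for `z_{p_{i+1}}`.
It carries the maximum of the Euclidean norms of the blocks, which is equivalent to the Euclidean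
norm; none of the notions used here depends on the choice between equivalent norms. -/
abbrev State (n : ℕ) : Type := (Fin n → E3) × E3

/-- The skew-symmetric matrix `S(v)`, i.e. `S(v) w = v × w`. -/
def skew (v : E3) : Matrix (Fin 3) (Fin 3) ℝ :=
  !![0, -v 2, v 1;
     v 2, 0, -v 0;
     -v 1, v 0, 0]

/-- The vector `S(u)² w`. -/
noncomputable def skewSq (u w : E3) : E3 := WithLp.toLp 2 ((skew u ^ 2).mulVec w.ofLp)

/-- `{z ∈ ℝ³ | e_z - z ∈ S²}`. -/
def shiftedSphere (ez : E3) : Set E3 := {z | ez - z ∈ Metric.sphere (0 : E3) 1}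

/-- `Υ_n = ℝ^{3n} × {z | e_z - z ∈ S²}`. -/
def upsilon (n : ℕ) (ez : E3) : Set (State n) := univ ×ˢ shiftedSphere ez

/-- `Υ_n^* = ℝ^{3n} × ({z | e_z - z ∈ S²} \ {2 e_z})`. -/
def upsilonStar (n : ℕ) (ez : E3) : Set (State n) :=
  univ ×ˢ (shiftedSphere ez \ {(2 : ℝ) • ez})

/-- The right-hand side `F_n` of the error dynamics, `α i` standing for `α_{i+1}`:
`ż_{p_i} = z_{p_{i+1}}` for `i < n`, `ż_{p_n} = - ∑ α_i z_{p_i}`,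
`ż₂ = γ S²(e_z - z₂) (z₂ - z_{p_1})`. -/
noncomputable def errorField {n : ℕ} [NeZero n] (ez : E3) (α : Fin n → ℝ) (γ : ℝ) (ξ : State n) :
    State n :=
  (fun i => if h : (i : ℕ) + 1 < n then ξ.1 ⟨(i : ℕ) + 1, h⟩ else -∑ j, α j • ξ.1 j,
    γ • skewSq (ez - ξ.2) (ξ.2 - ξ.1 0))

/-- The polynomial `s^n + α_n s^{n-1} + ⋯ + α_2 s + α_1`. -/
noncomputable def gainPolynomial {n : ℕ} (α : Fin n → ℝ) : Polynomial ℝ :=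
  Polynomial.X ^ n + ∑ i : Fin n, Polynomial.C (α i) * Polynomial.X ^ (i : ℕ)

/-- A real polynomial is Hurwitz when all its complex roots have negative real part. -/
def IsHurwitz (p : Polynomial ℝ) : Prop :=
  ∀ s : ℂ, Polynomial.aeval s p = 0 → s.re < 0

/-- Admissible gains: all `α_i` and `γ` are positive and the gain polynomial is Hurwitz. -/
def AdmissibleGains {n : ℕ} (α : Fin n → ℝ) (γ : ℝ) : Prop :=
  (∀ i, 0 < α i) ∧ IsHurwitz (gainPolynomial α) ∧ 0 < γ

end TiltObserver

/-! The linear chain `z_p` does not see `z₂` and decays exponentially because its polynomial is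
Hurwitz (`exists_decay_of_isHurwitz`). Put `e = e_z`, `x = e_z - z₂`, `u = z_{p_1}`. Then `x` runs
on the unit sphere along the projected field `γ (v - ⟪x, v⟫ x)` with `v = e - u`, a perturbation of
the gradient flow of the height `h = ⟪e, x⟫`, whose critical points are `e` (origin) and `-e` (the
point `2 e_z`).

Here `h' ≥ γ (1 - h²) - γ ‖u‖` and `u` is integrable, so `h` minus the remaining influence of `u` is
nondecreasing and bounded. Its limit can only be `±1` (`IsSphereSolution.tendsto_inner`), which
gives the two possible limits. The same monotonicity says how much height can be lost after time `s`
(`IsSphereSolution.le_inner`); Lyapunov stability and openness of the basin rest on it. While `h`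
stays away from `-1`, a weighted energy yields exponential convergence
(`IsSphereSolution.norm_sub_sq_le`).

The basin is dense because `-e` repels: two solutions with the same `u` that both tend to `-e` would
have to separate, so they coincide (`IsSphereSolution.eq_of_tendsto_neg`). Hence each initial value
of the chain has at most one bad `z₂`, and the sphere has no isolated points.

For a prescribed rate, `γ` is fixed by the distance of `K` from the bad point, and then the chain is
accelerated by a factor `k`. The later blocks may peak like powers of `k`, but the first block, the
only one acting on `z₂`, does not (`IsChainSolution.norm_le_rescale`); the loss of height is
therefore of order `1 / k`. -/

namespace TiltObserver

/-! ### Monotonicity from one-sided derivatives on `[0, ∞)` -/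

section RealFunctions

variable {F : Type*} [NormedAddCommGroup F] [NormedSpace ℝ F]

lemma continuousOn_of_hasDerivWithinAt_Ici {g g' : ℝ → F}
    (hg : ∀ t : ℝ, 0 ≤ t → HasDerivWithinAt g (g' t) (Ici 0) t) : ContinuousOn g (Ici 0) :=
  fun t ht => (hg t ht).continuousWithinAt

lemma monotoneOn_of_hasDerivWithinAt_Ici {g g' : ℝ → ℝ} {T : ℝ} (hT : 0 ≤ T)
    (hg : ∀ t : ℝ, 0 ≤ t → HasDerivWithinAt g (g' t) (Ici 0) t)
    (hg' : ∀ t, T ≤ t → 0 ≤ g' t) : MonotoneOn g (Ici T) := by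
  refine monotoneOn_of_hasDerivWithinAt_nonneg (f' := g') (convex_Ici T)
    ((continuousOn_of_hasDerivWithinAt_Ici hg).mono (Ici_subset_Ici.2 hT)) ?_ ?_
  · intro t ht
    rw [interior_Ici] at ht ⊢
    exact (hg t (hT.trans (le_of_lt ht))).mono
      (Ioi_subset_Ici_self.trans (Ici_subset_Ici.2 hT))
  · intro t ht
    rw [interior_Ici] at ht
    exact hg' t (le_of_lt ht)

lemma antitoneOn_of_hasDerivWithinAt_Ici {g g' : ℝ → ℝ}
    (hg : ∀ t : ℝ, 0 ≤ t → HasDerivWithinAt g (g' t) (Ici 0) t)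
    (hg' : ∀ t, 0 ≤ t → g' t ≤ 0) : AntitoneOn g (Ici 0) := by
  have h := monotoneOn_of_hasDerivWithinAt_Ici le_rfl (fun t ht => (hg t ht).neg)
    (fun t ht => neg_nonneg.2 (hg' t ht))
  intro a ha b hb hab
  have := h ha hb hab
  simpa using this

end RealFunctions

/-! ### Existence, uniqueness and continuous dependence for `C¹` autonomous fields -/

section Existence

variable {E : Type*} [NormedAddCommGroup E] [NormedSpace ℝ E]

lemma eqOn_Icc_of_contDiff [FiniteDimensional ℝ E] {f : E → E} (hf : ContDiff ℝ 1 f) {T : ℝ}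
    {ξ η : ℝ → E} (hξ : ∀ t ∈ Icc 0 T, HasDerivWithinAt ξ (f (ξ t)) (Icc 0 T) t)
    (hη : ∀ t ∈ Icc 0 T, HasDerivWithinAt η (f (η t)) (Icc 0 T) t) (h0 : ξ 0 = η 0) :
    EqOn ξ η (Icc 0 T) := by
  have hξc : ContinuousOn ξ (Icc 0 T) := fun t ht => (hξ t ht).continuousWithinAt
  have hηc : ContinuousOn η (Icc 0 T) := fun t ht => (hη t ht).continuousWithinAt
  obtain ⟨R₁, hR₁⟩ := (isCompact_Icc.image_of_continuousOn hξc).isBounded.subset_closedBall 0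
  obtain ⟨R₂, hR₂⟩ := (isCompact_Icc.image_of_continuousOn hηc).isBounded.subset_closedBall 0
  obtain ⟨L, hL⟩ := (hf.contDiffOn (s := Metric.closedBall (0 : E) (max R₁ R₂))).exists_lipschitzOnWith
    one_ne_zero (convex_closedBall _ _) (isCompact_closedBall _ _)
  have key : ∀ {ζ : ℝ → E}, (∀ t ∈ Icc 0 T, HasDerivWithinAt ζ (f (ζ t)) (Icc 0 T) t) →
      ∀ t ∈ Ico 0 T, HasDerivWithinAt ζ (f (ζ t)) (Ici t) t := by
    intro ζ hζ t ht
    exact ((hζ t (Ico_subset_Icc_self ht)).mono (Icc_subset_Icc_left ht.1)).mono_of_mem_nhdsWithin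
      (Icc_mem_nhdsGE ht.2)
  refine ODE_solution_unique_of_mem_Icc_right (v := fun _ => f)
    (s := fun _ => Metric.closedBall 0 (max R₁ R₂)) (fun t _ => hL) hξc (key hξ) ?_ hηc (key hη) ?_ h0
  · exact fun t ht => Metric.closedBall_subset_closedBall (le_max_left _ _)
      (hR₁ (mem_image_of_mem _ (Ico_subset_Icc_self ht)))
  · exact fun t ht => Metric.closedBall_subset_closedBall (le_max_right _ _)
      (hR₂ (mem_image_of_mem _ (Ico_subset_Icc_self ht)))

lemma exists_solution_Icc_of_hasCompactSupport [FiniteDimensional ℝ E] {f : E → E}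
    (hf : ContDiff ℝ 1 f) (hfs : HasCompactSupport f) (x : E) {T : ℝ} (hT : 0 ≤ T) :
    ∃ ξ : ℝ → E, ξ 0 = x ∧ ∀ t ∈ Icc 0 T, HasDerivWithinAt ξ (f (ξ t)) (Icc 0 T) t := by
  obtain ⟨K, hK⟩ := ContDiff.lipschitzWith_of_hasCompactSupport hfs hf one_ne_zero
  obtain ⟨L, hL⟩ := hf.continuous.bounded_above_of_compact_support hfs
  have hL0 : 0 ≤ L := (norm_nonneg _).trans (hL x)
  -- A solution with speed at most `L` cannot leave the ball of radius `L * T` within time `T`, so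
  -- one Picard–Lindelöf step covers all of `[0, T]`.
  have hPL : IsPicardLindelof (fun _ => f) (⟨0, left_mem_Icc.2 hT⟩ : Icc 0 T) x
      (L.toNNReal * T.toNNReal) 0 L.toNNReal K :=
    { lipschitzOnWith := fun t _ => hK.lipschitzOnWith
      continuousOn := fun _ _ => continuousOn_const
      norm_le := fun t _ y _ => by simpa [Real.coe_toNNReal _ hL0] using hL y
      mul_max_le := by simp [Real.coe_toNNReal _ hL0, Real.coe_toNNReal _ hT, hT] }
  exact hPL.exists_eq_forall_mem_Icc_hasDerivWithinAt₀

lemma exists_solution_Ici [FiniteDimensional ℝ E] {f : E → E} (hf : ContDiff ℝ 1 f) (x : E)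
    (h : ∀ T : ℝ, 0 ≤ T →
      ∃ ξ : ℝ → E, ξ 0 = x ∧ ∀ t ∈ Icc 0 T, HasDerivWithinAt ξ (f (ξ t)) (Icc 0 T) t) :
    ∃ ξ : ℝ → E, ξ 0 = x ∧ ∀ t : ℝ, 0 ≤ t → HasDerivWithinAt ξ (f (ξ t)) (Ici 0) t := by
  choose! ζ hζ0 hζ using h
  have hEq : ∀ {S T : ℝ}, 0 ≤ S → S ≤ T → EqOn (ζ S) (ζ T) (Icc 0 S) := fun {S T} hS hST =>
    eqOn_Icc_of_contDiff hf (hζ S hS)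
      (fun t ht => (hζ T (hS.trans hST) t (Icc_subset_Icc_right hST ht)).mono
        (Icc_subset_Icc_right hST)) (by rw [hζ0 S hS, hζ0 T (hS.trans hST)])
  have hloc : ∀ T : ℝ, ∀ t ∈ Icc 0 T, ζ t t = ζ T t := fun T t ht => hEq ht.1 ht.2 ⟨ht.1, le_rfl⟩
  -- Solutions on different intervals agree on overlaps, so the diagonal glues them. Near `t` it is
  -- compared with the solution on `[0, t + 1]`, for which `t` is not a right endpoint.
  refine ⟨fun t => ζ t t, hζ0 0 le_rfl, fun t ht => ?_⟩
  have h1 := hζ (t + 1) (by linarith) t ⟨ht, by linarith⟩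
  have h2 : HasDerivWithinAt (ζ (t + 1)) (f (ζ t t)) (Ici 0) t := by
    rw [hloc (t + 1) t ⟨ht, by linarith⟩]
    refine h1.mono_of_mem_nhdsWithin ?_
    rw [mem_nhdsWithin]
    exact ⟨Iio (t + 1), isOpen_Iio, by simp, fun s hs => ⟨hs.2, le_of_lt hs.1⟩⟩
  refine h2.congr_of_eventuallyEq ?_ (hloc _ _ ⟨ht, by linarith⟩)
  filter_upwards [inter_mem_nhdsWithin (Ici (0:ℝ)) (Iio_mem_nhds (show t < t + 1 by linarith))]
    with s hs
  exact hloc _ _ ⟨hs.1, le_of_lt hs.2⟩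

/-- A `C¹` field has a global solution from `x` as soon as the solutions of the fields obtained by
multiplying it by cut-off functions stay bounded on bounded time intervals. -/
lemma exists_solution_of_cutoff_bound [FiniteDimensional ℝ E] {f : E → E} (hf : ContDiff ℝ 1 f)
    (x : E) (h : ∀ T : ℝ, 0 ≤ T → ∃ R : ℝ, ∀ χ : ℝ → ℝ, ∀ ξ : ℝ → E, ξ 0 = x →
      (∀ t, χ t ∈ Icc (0 : ℝ) 1) →
      (∀ t ∈ Icc 0 T, HasDerivWithinAt ξ (χ t • f (ξ t)) (Icc 0 T) t) →
      ∀ t ∈ Icc 0 T, ‖ξ t‖ ≤ R) :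
    ∃ ξ : ℝ → E, ξ 0 = x ∧ ∀ t : ℝ, 0 ≤ t → HasDerivWithinAt ξ (f (ξ t)) (Ici 0) t := by
  refine exists_solution_Ici hf x fun T hT => ?_
  obtain ⟨R, hR⟩ := h T hT
  -- The bump equals `1` on the ball of radius `max R 1`. The bound `R` holds for every cut-off
  -- factor, in particular for `b` along the solution, so the solution never meets the region where
  -- the field was changed.
  let b : ContDiffBump (0 : E) := ⟨max R 1, max R 1 + 1, by positivity, by linarith⟩
  obtain ⟨ξ, hξ0, hξ⟩ := exists_solution_Icc_of_hasCompactSupport (f := fun y => b y • f y)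
    (b.contDiff.smul hf) b.hasCompactSupport.smul_right x hT
  refine ⟨ξ, hξ0, fun t ht => ?_⟩
  have := hξ t ht
  have hb := hR (fun t => b (ξ t)) ξ hξ0 (fun t => ⟨b.nonneg, b.le_one⟩) hξ t ht
  rwa [b.one_of_mem_closedBall (by simp [b, hb]), one_smul] at this

lemma IsTrajectory.eqOn_Ici [FiniteDimensional ℝ E] {f : E → E} (hf : ContDiff ℝ 1 f)
    {X : Set E} {ξ η : ℝ → E} (hξ : IsTrajectory f X ξ) (hη : IsTrajectory f X η)
    (h0 : ξ 0 = η 0) : EqOn ξ η (Ici 0) := fun t ht =>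
  eqOn_Icc_of_contDiff hf (T := t) (fun s hs => (hξ s hs.1).2.mono Icc_subset_Ici_self)
    (fun s hs => (hη s hs.1).2.mono Icc_subset_Ici_self) h0 ⟨ht, le_rfl⟩

lemma isStateSpace_of_exists_trajectory [FiniteDimensional ℝ E] {f : E → E} (hf : ContDiff ℝ 1 f)
    {X : Set E} (h : ∀ x ∈ X, ∃ ξ : ℝ → E, IsTrajectory f X ξ ∧ ξ 0 = x) :
    IsStateSpace f X := by
  intro x hx
  obtain ⟨ξ, hξ, hξ0⟩ := h x hx
  refine ⟨ξ, hξ, hξ0, fun T _ η hη0 hη t ht => ?_⟩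
  exact eqOn_Icc_of_contDiff hf (T := t)
    (fun s hs => (hη s ⟨hs.1, hs.2.trans_lt ht.2⟩).mono fun r hr => ⟨hr.1, hr.2.trans_lt ht.2⟩)
    (fun s hs => (hξ s hs.1).2.mono Icc_subset_Ici_self) (hη0.trans hξ0.symm) ⟨ht.1, le_rfl⟩

/-- Trajectories that remain in a fixed bounded set depend continuously on the initial value. -/
lemma exists_dist_le_mul_of_trajectories [FiniteDimensional ℝ E] {f : E → E}
    (hf : ContDiff ℝ 1 f) (X : Set E) (R T : ℝ) :
    ∃ C : ℝ, 0 < C ∧ ∀ ξ η : ℝ → E, IsTrajectory f X ξ → IsTrajectory f X η →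
      (∀ t : ℝ, 0 ≤ t → ‖ξ t‖ ≤ R) → (∀ t : ℝ, 0 ≤ t → ‖η t‖ ≤ R) → ∀ t ∈ Icc 0 T,
      dist (ξ t) (η t) ≤ C * dist (ξ 0) (η 0) := by
  obtain ⟨L, hL⟩ := (hf.contDiffOn (s := Metric.closedBall (0 : E) R)).exists_lipschitzOnWith
    one_ne_zero (convex_closedBall _ _) (isCompact_closedBall _ _)
  refine ⟨Real.exp (L * T), Real.exp_pos _, fun ξ η hξ hη hξR hηR t ht => ?_⟩
  have key : ∀ {ζ : ℝ → E}, IsTrajectory f X ζ →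
      ∀ t ∈ Ico 0 T, HasDerivWithinAt ζ (f (ζ t)) (Ici t) t := fun hζ t ht =>
    (hζ t ht.1).2.mono (Ici_subset_Ici.2 ht.1)
  have hc : ∀ {ζ : ℝ → E}, IsTrajectory f X ζ → ContinuousOn ζ (Icc 0 T) := fun hζ t ht =>
    ((hζ t ht.1).2.mono Icc_subset_Ici_self).continuousWithinAt
  have := dist_le_of_trajectories_ODE_of_mem (v := fun _ => f)
    (s := fun _ => Metric.closedBall 0 R) (fun t _ => hL) (hc hξ) (key hξ)
    (fun t ht => by simpa using hξR t ht.1) (hc hη) (key hη)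
    (fun t ht => by simpa using hηR t ht.1) le_rfl t ht
  refine this.trans ?_
  rw [mul_comm]
  gcongr
  linarith [ht.2]

end Existence

/-! ### Exponential decay for linear systems annihilated by a polynomial -/

section Decay

open Polynomial

variable {V : Type*} [NormedAddCommGroup V] [NormedSpace ℂ V]

/-- Variation of constants: `exp (-r t) f` has derivative `exp (-r t) g`, of norm at most `M exp (κ
t)` with `κ = -β - r.re`. The strict inequality `κ > 0` avoids polynomial factors in `t`, even for
repeated roots. -/
lemma norm_le_of_hasDerivWithinAt_linear {f g : ℝ → V} {r : ℂ} {β M : ℝ} (hr : r.re < -β)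
    (hM : 0 ≤ M) (hf : ∀ t : ℝ, 0 ≤ t → HasDerivWithinAt f (r • f t + g t) (Ici 0) t)
    (hg : ∀ t : ℝ, 0 ≤ t → ‖g t‖ ≤ M * Real.exp (-β * t)) {t : ℝ} (ht : 0 ≤ t) :
    ‖f t‖ ≤ (‖f 0‖ + M / (-β - r.re)) * Real.exp (-β * t) := by
  set κ := -β - r.re with hκ
  have hκ0 : 0 < κ := by linarith
  have hexp : ∀ t : ℝ, HasDerivAt (fun s : ℝ => Complex.exp (-r * s))
      (-r * Complex.exp (-r * t)) t := by
    intro t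
    have h1 : HasDerivAt (fun s : ℝ => -r * (s : ℂ)) (-r) t := by
      simpa using (Complex.ofRealCLM.hasDerivAt (x := t)).const_mul (-r)
    simpa [mul_comm] using h1.cexp
  have hnorm : ∀ t : ℝ, ‖Complex.exp (-r * t)‖ = Real.exp (-r.re * t) := by
    intro t
    rw [Complex.norm_exp]
    simp
  have hd : ∀ t : ℝ, 0 ≤ t → HasDerivWithinAt (fun s : ℝ => Complex.exp (-r * s) • f s)
      (Complex.exp (-r * t) • g t) (Ici 0) t := by
    intro t ht
    refine ((hexp t).hasDerivWithinAt.smul (hf t ht)).congr_deriv ?_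
    module
  have hB : ∀ t : ℝ, HasDerivAt (fun s => ‖f 0‖ + M / κ * Real.exp (κ * s))
      (M * Real.exp (κ * t)) t := by
    intro t
    have h1 : HasDerivAt (fun s : ℝ => κ * s) κ t := by
      simpa using (hasDerivAt_id t).const_mul κ
    refine ((h1.exp.const_mul (M / κ)).const_add ‖f 0‖).congr_deriv ?_
    field_simp
  have hmain := image_norm_le_of_norm_deriv_right_le_deriv_boundary (a := 0) (b := t)
    (fun s hs => ((hd s hs.1).mono Icc_subset_Ici_self).continuousWithinAt)
    (fun s hs => (hd s hs.1).mono (Ici_subset_Ici.2 hs.1))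
    (B := fun s => ‖f 0‖ + M / κ * Real.exp (κ * s))
    (by simp only [Complex.ofReal_zero, mul_zero, Complex.exp_zero, one_smul, Real.exp_zero, mul_one]
        have := div_nonneg hM hκ0.le
        linarith) hB
    (by
      intro s hs
      rw [norm_smul, hnorm]
      calc Real.exp (-r.re * s) * ‖g s‖
          ≤ Real.exp (-r.re * s) * (M * Real.exp (-β * s)) := by gcongr; exact hg s hs.1
        _ = M * (Real.exp (-r.re * s) * Real.exp (-β * s)) := by ring
        _ = M * Real.exp (κ * s) := by rw [← Real.exp_add]; congr 2; rw [hκ]; ring)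
    ⟨ht, le_rfl⟩
  rw [norm_smul, hnorm] at hmain
  have h1 : ‖f t‖ = Real.exp (r.re * t) * (Real.exp (-r.re * t) * ‖f t‖) := by
    rw [← mul_assoc, ← Real.exp_add]; simp
  have h2 : Real.exp (r.re * t) * Real.exp (κ * t) = Real.exp (-β * t) := by
    rw [← Real.exp_add]; congr 1; rw [hκ]; ring
  have h3 : Real.exp (r.re * t) ≤ Real.exp (-β * t) :=
    Real.exp_le_exp.2 (mul_le_mul_of_nonneg_right hr.le ht)
  calc ‖f t‖ ≤ Real.exp (r.re * t) * (‖f 0‖ + M / κ * Real.exp (κ * t)) := by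
        rw [h1]; gcongr
    _ = ‖f 0‖ * Real.exp (r.re * t) + M / κ * (Real.exp (r.re * t) * Real.exp (κ * t)) := by ring
    _ ≤ ‖f 0‖ * Real.exp (-β * t) + M / κ * Real.exp (-β * t) := by rw [h2]; gcongr
    _ = _ := by ring

/-- If a product of linear factors whose roots have real part less than `-β` annihilates
`q(A)`, then `q(A)` times a solution of `ψ' = A ψ` decays like `exp (-β t)`. -/
lemma exists_norm_aeval_le (A : V →L[ℂ] V) (β : ℝ) (s : Multiset ℂ) :
    (∀ r ∈ s, r.re < -β) → ∀ q : ℂ[X], aeval A ((s.map fun r => X - C r).prod * q) = 0 →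
    ∃ M : ℝ, 0 ≤ M ∧ ∀ ψ : ℝ → V, (∀ t : ℝ, 0 ≤ t → HasDerivWithinAt ψ (A (ψ t)) (Ici 0) t) →
      ∀ t : ℝ, 0 ≤ t → ‖aeval A q (ψ t)‖ ≤ M * ‖ψ 0‖ * Real.exp (-β * t) := by
  induction s using Multiset.induction_on with
  | empty =>
    intro _ q hq
    refine ⟨0, le_rfl, fun ψ _ t _ => ?_⟩
    simp only [Multiset.map_zero, Multiset.prod_zero, one_mul] at hq
    simp [hq]
  | cons r s ih =>
    intro hs q hq
    -- With `f = q(A) ψ` one has `f' = r f + ((X - r) q)(A) ψ`; the induction hypothesis bounds the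
    -- forcing term, since moving the factor `X - r` into `q` leaves the annihilating product
    -- unchanged.
    obtain ⟨M, hM0, hM⟩ := ih (fun r' hr' => hs r' (Multiset.mem_cons_of_mem hr')) ((X - C r) * q)
      (by rw [← hq]; simp only [Multiset.map_cons, Multiset.prod_cons]; congr 1; ring)
    have hr := hs r (Multiset.mem_cons_self r s)
    have hκ : 0 < -β - r.re := by linarith
    refine ⟨‖aeval A q‖ + M / (-β - r.re), by positivity, fun ψ hψ t ht => ?_⟩
    have hd : ∀ t : ℝ, 0 ≤ t → HasDerivWithinAt (fun s => aeval A q (ψ s))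
        (r • aeval A q (ψ t) + aeval A ((X - C r) * q) (ψ t)) (Ici 0) t := by
      intro t ht
      have h1 := ((aeval A q).restrictScalars ℝ).hasFDerivAt.comp_hasDerivWithinAt t (hψ t ht)
      refine h1.congr_deriv ?_
      have h2 : aeval A ((X - C r) * q) = aeval A q * A - r • aeval A q := by
        rw [mul_comm, map_mul, map_sub, aeval_X, aeval_C, mul_sub, Algebra.algebraMap_eq_smul_one,
          mul_smul_comm, mul_one]
      rw [h2]
      simp
    have := norm_le_of_hasDerivWithinAt_linear hr (by positivity : 0 ≤ M * ‖ψ 0‖) hd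
      (fun t ht => hM ψ hψ t ht) ht
    refine this.trans ?_
    gcongr
    calc ‖aeval A q (ψ 0)‖ + M * ‖ψ 0‖ / (-β - r.re)
        ≤ ‖aeval A q‖ * ‖ψ 0‖ + M * ‖ψ 0‖ / (-β - r.re) := by
          gcongr; exact ContinuousLinearMap.le_opNorm _ _
      _ = _ := by ring

lemma exists_norm_le_of_aeval_eq_zero (A : V →L[ℂ] V) {β : ℝ} {p : ℂ[X]} (hp : p.Monic)
    (hroots : ∀ r ∈ p.roots, r.re < -β) (hA : aeval A p = 0) :
    ∃ M : ℝ, 0 ≤ M ∧ ∀ ψ : ℝ → V, (∀ t : ℝ, 0 ≤ t → HasDerivWithinAt ψ (A (ψ t)) (Ici 0) t) →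
      ∀ t : ℝ, 0 ≤ t → ‖ψ t‖ ≤ M * ‖ψ 0‖ * Real.exp (-β * t) := by
  have h := exists_norm_aeval_le A β p.roots hroots 1 (by
    rw [mul_one, ← (IsAlgClosed.splits p).eq_prod_roots_of_monic hp, hA])
  simpa using h

end Decay

/-! ### The chain of integrators: companion operator, decay, time scaling -/

section Companion

open Polynomial

variable {n : ℕ}

/-- The chain of integrators closed by the linear feedback `-∑ a_j ψ_j`. -/
def chain {𝕜 E : Type*} [AddCommGroup E] [SMul 𝕜 E] (a : Fin n → 𝕜) (ψ : Fin n → E) : Fin n → E :=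
  fun i => if h : (i : ℕ) + 1 < n then ψ ⟨(i : ℕ) + 1, h⟩ else -∑ j, a j • ψ j

/-- The chain of integrators over `ℂ` as an operator. -/
noncomputable def chainCLM (a : Fin n → ℂ) : (Fin n → ℂ) →L[ℂ] (Fin n → ℂ) :=
  LinearMap.toContinuousLinearMap
    { toFun := chain a
      map_add' := by
        intro ψ φ
        ext i
        simp only [chain, Pi.add_apply]
        split_ifs
        · rfl
        · simp only [smul_add, Finset.sum_add_distrib, neg_add]
      map_smul' := by
        intro c ψ
        ext i
        simp only [chain, Pi.smul_apply, RingHom.id_apply]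
        split_ifs
        · rfl
        · rw [smul_neg, Finset.smul_sum]
          simp only [smul_comm c] }

lemma chainCLM_apply (a : Fin n → ℂ) (ψ : Fin n → ℂ) : chainCLM a ψ = chain a ψ := rfl

lemma chainCLM_pow_apply_zero [NeZero n] (a : Fin n → ℂ) :
    ∀ (k : ℕ) (hk : k < n) (ψ : Fin n → ℂ), (chainCLM a ^ k) ψ 0 = ψ ⟨k, hk⟩ := by
  intro k
  induction k with
  | zero => intro hk ψ; rfl
  | succ k ih =>
    intro hk ψ
    rw [pow_succ, mul_apply_eq_comp, ih (by omega), chainCLM_apply]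
    simp [chain, hk]

lemma chainCLM_pow_self_apply_zero [NeZero n] (a : Fin n → ℂ) (ψ : Fin n → ℂ) :
    (chainCLM a ^ n) ψ 0 = -∑ j, a j * ψ j := by
  have hn : 0 < n := Nat.pos_of_ne_zero (NeZero.ne n)
  obtain ⟨m, rfl⟩ : ∃ m, n = m + 1 := ⟨n - 1, by omega⟩
  rw [pow_succ, mul_apply_eq_comp, chainCLM_pow_apply_zero _ _ (by omega),
    chainCLM_apply]
  simp [chain]

/-- Cayley–Hamilton for the companion operator `A`. Coordinate `0` of `A ^ k ψ` is `ψ k`, and the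
last row closes the recursion, so coordinate `0` of `p(A) ψ` vanishes for every `ψ`. Coordinate `i`
of `p(A) ψ` is coordinate `0` of `A ^ i p(A) ψ = p(A) A ^ i ψ`, hence also zero. -/
lemma aeval_chainCLM [NeZero n] (a : Fin n → ℂ) :
    aeval (chainCLM a) (X ^ n + ∑ i : Fin n, C (a i) * X ^ (i : ℕ)) = 0 := by
  set p : ℂ[X] := X ^ n + ∑ i : Fin n, C (a i) * X ^ (i : ℕ) with hp
  have h0 : ∀ ψ, aeval (chainCLM a) p ψ 0 = 0 := by
    intro ψ
    simp only [hp, map_add, map_sum, map_mul, map_pow, aeval_X, aeval_C,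
      Algebra.algebraMap_eq_smul_one, smul_mul_assoc, one_mul, add_apply,
      sum_apply, Pi.add_apply, Finset.sum_apply, smul_apply,
      Pi.smul_apply, smul_eq_mul, chainCLM_pow_self_apply_zero]
    rw [neg_add_eq_zero]
    exact Finset.sum_congr rfl fun i _ => by rw [chainCLM_pow_apply_zero a i i.2]
  ext1 ψ
  ext1 i
  have h1 := chainCLM_pow_apply_zero a i i.2 (aeval (chainCLM a) p ψ)
  rw [Fin.eta] at h1
  rw [← h1, ← mul_apply_eq_comp]
  have h2 : chainCLM a ^ (i : ℕ) * aeval (chainCLM a) p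
      = aeval (chainCLM a) p * chainCLM a ^ (i : ℕ) := by
    have : chainCLM a ^ (i : ℕ) = aeval (chainCLM a) (X ^ (i : ℕ) : ℂ[X]) := by simp
    rw [this, ← map_mul, ← map_mul, mul_comm]
  rw [h2, mul_apply_eq_comp, h0]
  rfl

lemma gainPolynomial_map (α : Fin n → ℝ) : (gainPolynomial α).map (algebraMap ℝ ℂ)
    = X ^ n + ∑ i : Fin n, C (α i : ℂ) * X ^ (i : ℕ) := by
  simp [gainPolynomial, Polynomial.map_sum]

lemma gainPolynomial_monic (α : Fin n → ℝ) : (gainPolynomial α).Monic := by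
  refine monic_X_pow_add ?_
  refine (degree_sum_le _ _).trans_lt ?_
  rw [Finset.sup_lt_iff (by exact WithBot.bot_lt_coe n)]
  intro i _
  exact (degree_C_mul_X_pow_le _ _).trans_lt (by exact_mod_cast i.2)

/-- The block functions `z_p` of the error dynamics, on `[0, ∞)`. -/
def IsChainSolution (α : Fin n → ℝ) (ψ : ℝ → Fin n → E3) : Prop :=
  ∀ t : ℝ, 0 ≤ t → HasDerivWithinAt ψ (chain α (ψ t)) (Ici 0) t

lemma exists_decay_of_isHurwitz [NeZero n] {α : Fin n → ℝ} (hα : IsHurwitz (gainPolynomial α)) :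
    ∃ β M : ℝ, 0 < β ∧ 0 ≤ M ∧ ∀ ψ, IsChainSolution α ψ →
      ∀ t : ℝ, 0 ≤ t → ‖ψ t‖ ≤ M * ‖ψ 0‖ * Real.exp (-β * t) := by
  set p : ℂ[X] := (gainPolynomial α).map (algebraMap ℝ ℂ) with hp
  have hmonic : p.Monic := (gainPolynomial_monic α).map _
  have hroot : ∀ r ∈ p.roots, r.re < 0 := by
    intro r hr
    refine hα r ?_
    have := isRoot_of_mem_roots hr
    rwa [IsRoot, hp, eval_map_algebraMap] at this
  -- There are finitely many roots, so their real parts have a common negative margin.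
  obtain ⟨β, hβ0, hβ⟩ : ∃ β : ℝ, 0 < β ∧ ∀ r ∈ p.roots, r.re < -β := by
    have hfin : ∀ᶠ β in 𝓝[>] (0 : ℝ), ∀ r ∈ p.roots.toFinset, r.re < -β := by
      rw [Filter.eventually_all_finset]
      intro r hr
      have h0 := hroot r (Multiset.mem_toFinset.1 hr)
      filter_upwards [nhdsWithin_le_nhds (Iio_mem_nhds (show (0 : ℝ) < -r.re by linarith))]
        with β hβ
      simp only [mem_Iio] at hβ
      linarith
    obtain ⟨β, h1, h2⟩ := (hfin.and self_mem_nhdsWithin).exists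
    exact ⟨β, h2, fun r hr => h1 r (Multiset.mem_toFinset.2 hr)⟩
  obtain ⟨M, hM0, hM⟩ := exists_norm_le_of_aeval_eq_zero (chainCLM fun i => (α i : ℂ)) hmonic hβ
    (by rw [hp, gainPolynomial_map]; exact aeval_chainCLM _)
  -- The complex estimate is applied to each of the three spatial coordinates; the factor `3` comes
  -- from bounding the Euclidean norm by the sum of absolute values.
  refine ⟨β, 3 * M, hβ0, by positivity, fun ψ hψ t ht => ?_⟩
  have hcoord : ∀ (c : Fin 3) (t : ℝ), 0 ≤ t → ∀ i,
      |ψ t i c| ≤ M * ‖ψ 0‖ * Real.exp (-β * t) := by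
    intro c t ht i
    have hd : ∀ t : ℝ, 0 ≤ t → HasDerivWithinAt (fun s j => ((ψ s j c : ℝ) : ℂ))
        (chainCLM (fun i => (α i : ℂ)) (fun j => ((ψ t j c : ℝ) : ℂ))) (Ici 0) t := by
      intro t ht
      rw [hasDerivWithinAt_pi]
      intro j
      have h1 := (hasDerivWithinAt_pi.1 (hψ t ht)) j
      have h2 := (Complex.ofRealCLM.comp (EuclideanSpace.proj c :
        E3 →L[ℝ] ℝ)).hasFDerivAt.comp_hasDerivWithinAt t h1
      refine h2.congr_deriv ?_
      simp only [chainCLM_apply, chain]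
      split_ifs
      · simp
      · simp
    have h3 := hM _ hd t ht
    have h4 : ‖fun j => ((ψ 0 j c : ℝ) : ℂ)‖ ≤ ‖ψ 0‖ := by
      rw [pi_norm_le_iff_of_nonneg (norm_nonneg _)]
      intro j
      rw [Complex.norm_real]
      exact (PiLp.norm_apply_le (ψ 0 j) c).trans (norm_le_pi_norm (ψ 0) j)
    calc |ψ t i c| = ‖((ψ t i c : ℝ) : ℂ)‖ := by rw [Complex.norm_real, Real.norm_eq_abs]
      _ ≤ ‖fun j => ((ψ t j c : ℝ) : ℂ)‖ := norm_le_pi_norm (fun j => ((ψ t j c : ℝ) : ℂ)) i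
      _ ≤ _ := h3
      _ ≤ _ := by gcongr
  rw [pi_norm_le_iff_of_nonneg (by positivity)]
  intro i
  have hsum : ‖ψ t i‖ ≤ ∑ c, |ψ t i c| := by
    rw [EuclideanSpace.norm_eq]
    refine Real.sqrt_le_iff.2 ⟨Finset.sum_nonneg fun _ _ => abs_nonneg _, ?_⟩
    exact Finset.sum_sq_le_sq_sum_of_nonneg fun _ _ => norm_nonneg _
  refine hsum.trans ((Finset.sum_le_sum fun c _ => hcoord c t ht i).trans ?_)
  simp [mul_assoc]

lemma IsChainSolution.sub {α : Fin n → ℝ} {ψ φ : ℝ → Fin n → E3} (hψ : IsChainSolution α ψ)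
    (hφ : IsChainSolution α φ) : IsChainSolution α (fun t => ψ t - φ t) := by
  intro t ht
  refine ((hψ t ht).sub (hφ t ht)).congr_deriv ?_
  ext1 i
  simp only [chain, Pi.sub_apply]
  split_ifs
  · rfl
  · simp only [smul_sub, Finset.sum_sub_distrib]
    abel

/-- The coefficients `a_i k^{n-i}`: the gains whose characteristic roots are those of `a`
multiplied by `k`. -/
def scaledGains (a : Fin n → ℝ) (k : ℝ) : Fin n → ℝ := fun i => a i * k ^ (n - (i : ℕ))

lemma IsChainSolution.rescale {a : Fin n → ℝ} {k : ℝ} (hk : 0 < k) {ψ : ℝ → Fin n → E3}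
    (hψ : IsChainSolution (scaledGains a k) ψ) :
    IsChainSolution a (fun t i => (k ^ (i : ℕ))⁻¹ • ψ (t / k) i) := by
  intro t ht
  rw [hasDerivWithinAt_pi]
  intro i
  have h1 : HasDerivWithinAt (fun s : ℝ => s / k) (1 / k) (Ici 0) t :=
    ((hasDerivAt_id t).div_const k).hasDerivWithinAt
  have h2 := (hψ (t / k) (by positivity)).scomp t h1 (fun s hs => div_nonneg hs hk.le)
  have h3 := (hasDerivWithinAt_pi.1 h2 i).const_smul ((k ^ (i : ℕ))⁻¹)
  refine h3.congr_deriv ?_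
  simp only [chain, Pi.smul_apply]
  split_ifs with h
  · rw [smul_smul, pow_succ]
    congr 1
    field_simp
  · have hi : (i : ℕ) + 1 = n := by omega
    rw [smul_neg, smul_neg, smul_smul, Finset.smul_sum]
    congr 1
    refine Finset.sum_congr rfl fun j _ => ?_
    rw [smul_smul, smul_smul, scaledGains]
    congr 1
    have hj : k ^ n = k ^ (n - (j : ℕ)) * k ^ (j : ℕ) := by
      rw [← pow_add]; congr 1; omega
    have hi' : k ^ n = k ^ (i : ℕ) * k := by rw [← pow_succ, hi]
    have : k ^ (n - (j : ℕ)) = k ^ (i : ℕ) * k / k ^ (j : ℕ) := by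
      rw [← hi', hj]; field_simp
    rw [this]
    field_simp

/-- Undoing the scaling turns time `t` into `k t` and block `i` into `k ^ (-i)` times itself. The
peaking factor `k ^ i` is `1` for `i = 0`: the first block gains the rate `β k` at no cost in
amplitude. -/
lemma IsChainSolution.norm_le_rescale [NeZero n] {a : Fin n → ℝ} {k β M : ℝ} (hk : 1 ≤ k)
    (hM : 0 ≤ M) (hdecay : ∀ ψ, IsChainSolution a ψ →
      ∀ t : ℝ, 0 ≤ t → ‖ψ t‖ ≤ M * ‖ψ 0‖ * Real.exp (-β * t))
    {ψ : ℝ → Fin n → E3} (hψ : IsChainSolution (scaledGains a k) ψ) {t : ℝ} (ht : 0 ≤ t)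
    (i : Fin n) :
    ‖ψ t i‖ ≤ k ^ (i : ℕ) * (M * ‖ψ 0‖ * Real.exp (-(β * k) * t)) := by
  have hk0 : 0 < k := by linarith
  have h := hdecay _ (hψ.rescale hk0) (k * t) (by positivity)
  have h0 : ‖fun i : Fin n => (k ^ (i : ℕ))⁻¹ • ψ (0 / k) i‖ ≤ ‖ψ 0‖ := by
    rw [pi_norm_le_iff_of_nonneg (norm_nonneg _)]
    intro j
    rw [norm_smul, zero_div, norm_inv, norm_pow, Real.norm_of_nonneg hk0.le]
    calc (k ^ (j : ℕ))⁻¹ * ‖ψ 0 j‖ ≤ 1 * ‖ψ 0 j‖ := by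
          gcongr; exact inv_le_one_of_one_le₀ (one_le_pow₀ hk)
      _ ≤ ‖ψ 0‖ := by rw [one_mul]; exact norm_le_pi_norm (ψ 0) j
  have h1 := norm_le_pi_norm (fun i : Fin n => (k ^ (i : ℕ))⁻¹ • ψ (k * t / k) i) i
  simp only [mul_div_cancel_left₀ t hk0.ne', norm_smul, norm_inv, norm_pow,
    Real.norm_of_nonneg hk0.le] at h1 h
  have h2 : ‖ψ t i‖ = k ^ (i : ℕ) * ((k ^ (i : ℕ))⁻¹ * ‖ψ t i‖) := by
    field_simp
  rw [h2]
  refine mul_le_mul_of_nonneg_left (h1.trans (h.trans ?_)) (by positivity)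
  have h3 : -β * (k * t) = -(β * k) * t := by ring
  rw [h3]
  gcongr

/-- The gains with characteristic polynomial `(s + 1)^n`. -/
def binomialGains (n : ℕ) : Fin n → ℝ := fun i => (n.choose i : ℝ)

lemma gainPolynomial_scaledGains_binomialGains (k : ℝ) :
    gainPolynomial (scaledGains (binomialGains n) k) = (X + C k) ^ n := by
  rw [add_pow, Finset.sum_range_succ, gainPolynomial, Finset.sum_range, add_comm]
  congr 1
  · refine Finset.sum_congr rfl fun i _ => ?_
    simp only [scaledGains, binomialGains, map_mul, map_pow, map_natCast]
    ring
  · simp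

lemma isHurwitz_scaledGains_binomialGains {k : ℝ} (hk : 0 < k) :
    IsHurwitz (gainPolynomial (scaledGains (binomialGains n) k)) := by
  intro s hs
  rw [gainPolynomial_scaledGains_binomialGains] at hs
  simp only [map_pow, map_add, aeval_X, aeval_C] at hs
  have h1 : s = -(k : ℂ) := eq_neg_of_add_eq_zero_left (eq_zero_of_pow_eq_zero hs)
  simpa [h1] using hk

lemma scaledGains_one (a : Fin n → ℝ) : scaledGains a 1 = a := by
  ext i; simp [scaledGains]

lemma admissibleGains_scaledGains_binomialGains {k γ : ℝ} (hk : 0 < k) (hγ : 0 < γ) :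
    AdmissibleGains (scaledGains (binomialGains n) k) γ := by
  refine ⟨fun i => ?_, isHurwitz_scaledGains_binomialGains hk, hγ⟩
  have : 0 < n.choose i := Nat.choose_pos i.2.le
  simp only [scaledGains, binomialGains]
  positivity

end Companion

/-! ### The perturbed gradient flow of the height on the unit sphere -/

section Sphere

open scoped RealInnerProductSpace

variable {E : Type*} [NormedAddCommGroup E] [InnerProductSpace ℝ E]

/-- The trajectories on the unit sphere of the projected field
`x ↦ γ (v - ⟪x, v⟫ x)` driven by `v`. -/
def IsSphereSolution (γ : ℝ) (v x : ℝ → E) : Prop :=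
  ∀ t : ℝ, 0 ≤ t → ‖x t‖ = 1 ∧
    HasDerivWithinAt x (γ • (v t - ⟪x t, v t⟫ • x t)) (Ici 0) t

variable {γ β N : ℝ} {e : E} {u v x y : ℝ → E}

/-- The left side pairs `w` with the tangential part of `e` at `x`, whose length is `√(1 - ⟪e, x⟫ ^
2)`. The perturbation of the height thus fades near both poles, which is what allows it to be
absorbed in `IsSphereSolution.norm_sub_sq_le`. -/
lemma abs_inner_sub_mul_inner_le {e x w : E} (he : ‖e‖ = 1) (hx : ‖x‖ = 1) :
    |⟪e, w⟫ - ⟪x, w⟫ * ⟪e, x⟫| ≤ √(1 - ⟪e, x⟫ ^ 2) * ‖w‖ := by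
  have h1 : ⟪e, w⟫ - ⟪x, w⟫ * ⟪e, x⟫ = ⟪e - ⟪e, x⟫ • x, w⟫ := by
    rw [inner_sub_left, real_inner_smul_left]; ring
  have h2 : ‖e - ⟪e, x⟫ • x‖ = √(1 - ⟪e, x⟫ ^ 2) := by
    rw [eq_comm, Real.sqrt_eq_iff_eq_sq _ (norm_nonneg _), norm_sub_sq_real, he, norm_smul, hx,
      real_inner_smul_right, mul_one, Real.norm_eq_abs, sq_abs]
    · ring
    · have := abs_real_inner_le_norm e x
      rw [he, hx, mul_one] at this
      nlinarith [sq_abs ⟪e, x⟫, abs_nonneg ⟪e, x⟫]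
  rw [h1, ← h2]
  exact abs_real_inner_le_norm _ _

lemma abs_inner_le_one {e x : E} (he : ‖e‖ = 1) (hx : ‖x‖ = 1) : |⟪e, x⟫| ≤ 1 := by
  simpa [he, hx] using abs_real_inner_le_norm e x

lemma norm_sub_sq_eq_of_norm_one {e x : E} (he : ‖e‖ = 1) (hx : ‖x‖ = 1) :
    ‖e - x‖ ^ 2 = 2 * (1 - ⟪e, x⟫) := by
  rw [norm_sub_sq_real, he, hx]; ring

lemma IsSphereSolution.hasDerivWithinAt_inner (he : ‖e‖ = 1)
    (hx : IsSphereSolution γ (fun t => e - u t) x) {t : ℝ} (ht : 0 ≤ t) :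
    HasDerivWithinAt (fun s => ⟪e, x s⟫)
      (γ * ((1 - ⟪e, x t⟫ ^ 2) - (⟪e, u t⟫ - ⟪x t, u t⟫ * ⟪e, x t⟫))) (Ici 0) t := by
  have h := (hasDerivWithinAt_const t (Ici 0) e).inner ℝ (hx t ht).2
  refine h.congr_deriv ?_
  simp only [inner_zero_left, add_zero, real_inner_smul_right, inner_sub_right,
    real_inner_self_eq_norm_sq, he, real_inner_comm e (x t)]
  ring

lemma hasDerivAt_exp_neg_mul (β t : ℝ) :
    HasDerivAt (fun s : ℝ => Real.exp (-β * s)) (-β * Real.exp (-β * t)) t := by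
  have h1 : HasDerivAt (fun s : ℝ => -β * s) (-β) t := by
    simpa using (hasDerivAt_id t).const_mul (-β)
  simpa [mul_comm] using h1.exp

/-- The height `⟪e, x⟫` corrected by the remaining influence of the perturbation `u`. -/
lemma IsSphereSolution.exists_hasDerivWithinAt_height (hγ : 0 < γ) (hβ : 0 < β) (he : ‖e‖ = 1)
    (hx : IsSphereSolution γ (fun t => e - u t) x)
    (hu : ∀ t : ℝ, 0 ≤ t → ‖u t‖ ≤ N * Real.exp (-β * t)) :
    ∃ H' : ℝ → ℝ, ∀ t : ℝ, 0 ≤ t →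
      HasDerivWithinAt (fun s => ⟪e, x s⟫ - γ * N / β * Real.exp (-β * s)) (H' t) (Ici 0) t ∧
      γ * (1 - ⟪e, x t⟫ ^ 2) ≤ H' t := by
  refine ⟨_, fun t ht => ⟨(hx.hasDerivWithinAt_inner he ht).sub
    ((hasDerivAt_exp_neg_mul β t).hasDerivWithinAt.const_mul (γ * N / β)), ?_⟩⟩
  have h1 := abs_inner_sub_mul_inner_le (w := u t) he (hx t ht).1
  have h2 : √(1 - ⟪e, x t⟫ ^ 2) ≤ 1 := by
    rw [Real.sqrt_le_one]
    nlinarith [sq_nonneg ⟪e, x t⟫]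
  have h3 : ⟪e, u t⟫ - ⟪x t, u t⟫ * ⟪e, x t⟫ ≤ N * Real.exp (-β * t) :=
    (le_abs_self _).trans (h1.trans ((mul_le_of_le_one_left (norm_nonneg _) h2).trans (hu t ht)))
  -- The correction term contributes `+γ N exp (-β t)` to the derivative, exactly the worst case of
  -- the perturbation.
  have h4 : γ * N / β * (-β * Real.exp (-β * t)) = -(γ * (N * Real.exp (-β * t))) := by
    field_simp
  rw [h4]
  nlinarith

lemma one_sub_inner_sq_nonneg {e x : E} (he : ‖e‖ = 1) (hx : ‖x‖ = 1) : 0 ≤ 1 - ⟪e, x⟫ ^ 2 := by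
  have := (sq_le_one_iff_abs_le_one _).2 (abs_inner_le_one he hx)
  linarith

lemma IsSphereSolution.monotoneOn_height (hγ : 0 < γ) (hβ : 0 < β) (he : ‖e‖ = 1)
    (hx : IsSphereSolution γ (fun t => e - u t) x)
    (hu : ∀ t : ℝ, 0 ≤ t → ‖u t‖ ≤ N * Real.exp (-β * t)) :
    MonotoneOn (fun s => ⟪e, x s⟫ - γ * N / β * Real.exp (-β * s)) (Ici 0) := by
  obtain ⟨H', hH⟩ := hx.exists_hasDerivWithinAt_height hγ hβ he hu
  exact monotoneOn_of_hasDerivWithinAt_Ici le_rfl (fun t ht => (hH t ht).1) fun t ht =>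
    (mul_nonneg hγ.le (one_sub_inner_sq_nonneg he (hx t ht).1)).trans (hH t ht).2

lemma IsSphereSolution.le_inner (hγ : 0 < γ) (hβ : 0 < β) (he : ‖e‖ = 1)
    (hx : IsSphereSolution γ (fun t => e - u t) x)
    (hu : ∀ t : ℝ, 0 ≤ t → ‖u t‖ ≤ N * Real.exp (-β * t)) {s t : ℝ} (hs : 0 ≤ s) (hst : s ≤ t) :
    ⟪e, x s⟫ - γ * N / β * Real.exp (-β * s) ≤ ⟪e, x t⟫ := by
  have h := hx.monotoneOn_height hγ hβ he hu hs (hs.trans hst : (0 : ℝ) ≤ t) hst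
  have hN : 0 ≤ N := by simpa using (norm_nonneg _).trans (hu 0 le_rfl)
  have : 0 ≤ γ * N / β * Real.exp (-β * t) := by positivity
  simp only at h
  linarith

lemma tendsto_exp_neg_mul_atTop (hβ : 0 < β) :
    Tendsto (fun t : ℝ => Real.exp (-β * t)) atTop (𝓝 0) :=
  Real.tendsto_exp_atBot.comp (tendsto_id.const_mul_atTop_of_neg (by linarith))

lemma IsSphereSolution.tendsto_inner (hγ : 0 < γ) (hβ : 0 < β) (he : ‖e‖ = 1)
    (hx : IsSphereSolution γ (fun t => e - u t) x)
    (hu : ∀ t : ℝ, 0 ≤ t → ‖u t‖ ≤ N * Real.exp (-β * t)) :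
    Tendsto (fun t => ⟪e, x t⟫) atTop (𝓝 1) ∨ Tendsto (fun t => ⟪e, x t⟫) atTop (𝓝 (-1)) := by
  set H : ℝ → ℝ := fun s => ⟪e, x s⟫ - γ * N / β * Real.exp (-β * s) with hH
  have hN : 0 ≤ N := by simpa using (norm_nonneg _).trans (hu 0 le_rfl)
  have hmono : MonotoneOn H (Ici 0) := hx.monotoneOn_height hγ hβ he hu
  have hle : ∀ t, 0 ≤ t → H t ≤ 1 := by
    intro t ht
    have h1 := (abs_le.1 (abs_inner_le_one he (hx t ht).1)).2
    have : 0 ≤ γ * N / β * Real.exp (-β * t) := by positivity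
    simp only [hH]
    linarith
  obtain ⟨L, hL⟩ : ∃ L, Tendsto H atTop (𝓝 L) := by
    have hm : Monotone fun t => H (max t 0) := fun a b hab =>
      hmono (le_max_right _ _ : (0 : ℝ) ≤ _) (le_max_right _ _ : (0 : ℝ) ≤ _)
        (max_le_max_right 0 hab)
    refine ⟨_, (tendsto_atTop_ciSup hm ⟨1, ?_⟩).congr' ?_⟩
    · rintro _ ⟨t, rfl⟩
      exact hle _ (le_max_right _ _)
    · filter_upwards [eventually_ge_atTop 0] with t ht
      rw [max_eq_left ht]
  have hxL : Tendsto (fun t => ⟪e, x t⟫) atTop (𝓝 L) := by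
    have := hL.add ((tendsto_exp_neg_mul_atTop hβ).const_mul (γ * N / β))
    simpa [hH] using this
  have hLabs : |L| ≤ 1 := by
    refine le_of_tendsto hxL.abs ?_
    filter_upwards [eventually_ge_atTop 0] with t ht
    exact abs_inner_le_one he (hx t ht).1
  by_cases hL1 : L ^ 2 = 1
  · rcases mul_self_eq_one_iff.1 ((sq L).symm.trans hL1) with h | h
    · exact Or.inl (h ▸ hxL)
    · exact Or.inr (h ▸ hxL)
  -- If `L ^ 2 < 1`, the corrected height eventually has slope at least `γ c > 0` and grows without
  -- bound, although it is at most `1`.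
  exfalso
  have hL2 : L ^ 2 < 1 := lt_of_le_of_ne ((sq_le_one_iff_abs_le_one _).2 hLabs) hL1
  obtain ⟨c, hc0, hc⟩ : ∃ c, 0 < c ∧ c < 1 - L ^ 2 := exists_between (by linarith)
  obtain ⟨T, hT⟩ := eventually_atTop.1
    (((tendsto_const_nhds (x := (1 : ℝ))).sub (hxL.pow 2)).eventually (lt_mem_nhds hc))
  obtain ⟨H', hH'⟩ := hx.exists_hasDerivWithinAt_height hγ hβ he hu
  have hm := monotoneOn_of_hasDerivWithinAt_Ici (g := fun t => H t - γ * c * t)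
    (le_max_right T 0) (fun t ht => (hH' t ht).1.sub
      (((hasDerivAt_id t).const_mul (γ * c)).hasDerivWithinAt)) (fun t ht => by
        have h1 := hT t ((le_max_left _ _).trans ht)
        have h2 := (hH' t ((le_max_right _ _).trans ht)).2
        nlinarith)
  set S := max T 0 with hS
  have hgrow : Tendsto (fun t => H S - γ * c * S + γ * c * t) atTop atTop :=
    tendsto_atTop_add_const_left _ _ (tendsto_id.const_mul_atTop (by positivity))
  obtain ⟨t, ht, htS⟩ := ((hgrow.eventually_gt_atTop 1).and (eventually_ge_atTop S)).exists
  have h1 := hm (self_mem_Ici : S ∈ Ici S) htS htS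
  have h2 := hle t ((le_max_right T 0).trans htS)
  simp only at h1
  linarith

/-- The sign of `⟪x + y, v⟫` decides between contraction (both points near the direction of `v`) and
separation (both near its antipode). -/
lemma IsSphereSolution.hasDerivWithinAt_norm_sub_sq (hx : IsSphereSolution γ v x)
    (hy : IsSphereSolution γ v y) {t : ℝ} (ht : 0 ≤ t) :
    HasDerivWithinAt (fun s => ‖x s - y s‖ ^ 2)
      (-γ * ⟪x t + y t, v t⟫ * ‖x t - y t‖ ^ 2) (Ici 0) t := by
  refine (((hx t ht).2.sub (hy t ht).2).norm_sq).congr_deriv ?_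
  have hxx : ⟪x t, x t⟫ = 1 := by rw [real_inner_self_eq_norm_sq, (hx t ht).1, one_pow]
  have hyy : ⟪y t, y t⟫ = 1 := by rw [real_inner_self_eq_norm_sq, (hy t ht).1, one_pow]
  have hyx : ⟪y t, x t⟫ = ⟪x t, y t⟫ := real_inner_comm _ _
  rw [norm_sub_sq_real, (hx t ht).1, (hy t ht).1]
  simp only [Pi.sub_apply, inner_sub_left, inner_sub_right, inner_add_left, real_inner_smul_right,
    hxx, hyy, hyx]
  ring

/-- Two solutions with the same driving term that converge to the antipode of its limit agree. -/
lemma IsSphereSolution.eq_of_tendsto_neg (hγ : 0 < γ) (he : ‖e‖ = 1)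
    (hx : IsSphereSolution γ v x) (hy : IsSphereSolution γ v y) {B : ℝ}
    (hvB : ∀ t : ℝ, 0 ≤ t → ‖v t‖ ≤ B) (hv : Tendsto v atTop (𝓝 e))
    (hxe : Tendsto x atTop (𝓝 (-e))) (hye : Tendsto y atTop (𝓝 (-e))) : x 0 = y 0 := by
  have hD := fun t ht => hx.hasDerivWithinAt_norm_sub_sq hy (t := t) ht
  have hlim : Tendsto (fun t => ⟪x t + y t, v t⟫) atTop (𝓝 (-2)) := by
    have := (hxe.add hye).inner (𝕜 := ℝ) hv
    convert this using 2
    rw [← two_smul ℝ (-e), real_inner_smul_left, inner_neg_left, real_inner_self_eq_norm_sq, he]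
    norm_num
  obtain ⟨T, hT⟩ := eventually_atTop.1 (hlim.eventually (gt_mem_nhds (show (-2 : ℝ) < 0 by norm_num)))
  set S := max T 0
  have hS0 : 0 ≤ S := le_max_right _ _
  have hm := monotoneOn_of_hasDerivWithinAt_Ici hS0 hD (fun t ht => by
    have := hT t ((le_max_left _ _).trans ht)
    have h2 := mul_pos hγ (neg_pos.2 this)
    have : 0 ≤ (γ * -⟪x t + y t, v t⟫) * ‖x t - y t‖ ^ 2 := by positivity
    linarith)
  -- From time `S` on the distance is nondecreasing, yet it tends to zero.
  have hS : ‖x S - y S‖ ^ 2 ≤ 0 := by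
    have h0 : Tendsto (fun t => ‖x t - y t‖ ^ 2) atTop (𝓝 0) := by
      simpa using (hxe.sub hye).norm.pow 2
    refine ge_of_tendsto h0 ?_
    filter_upwards [eventually_ge_atTop S] with t ht
    exact hm (self_mem_Ici : S ∈ Ici S) ht ht
  have hB0 : 0 ≤ B := (norm_nonneg _).trans (hvB 0 le_rfl)
  -- Backward uniqueness: since `⟪x + y, v⟫ ≤ 2 B`, the squared distance times `exp (2 γ B t)` is
  -- nondecreasing, so its vanishing at `S` forces it to vanish at `0`.
  have hm2 := monotoneOn_of_hasDerivWithinAt_Ici le_rfl (fun t ht =>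
    (hD t ht).mul (hasDerivAt_exp_neg_mul (-(2 * γ * B)) t).hasDerivWithinAt) (fun t ht => by
      have h1 : ⟪x t + y t, v t⟫ ≤ 2 * B := by
        refine (real_inner_le_norm _ _).trans ?_
        have h2 : ‖x t + y t‖ ≤ 2 := by
          refine (norm_add_le _ _).trans ?_
          rw [(hx t ht).1, (hy t ht).1]; norm_num
        exact mul_le_mul h2 (hvB t ht) (norm_nonneg _) (by norm_num)
      have h3 : 0 ≤ γ * (2 * B - ⟪x t + y t, v t⟫) := mul_nonneg hγ.le (by linarith)
      have : 0 ≤ γ * (2 * B - ⟪x t + y t, v t⟫) * (‖x t - y t‖ ^ 2 *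
        Real.exp (- -(2 * γ * B) * t)) := by positivity
      linarith)
  have h0 := hm2 (self_mem_Ici : (0 : ℝ) ∈ Ici 0) hS0 hS0
  simp only [Pi.mul_apply, mul_zero, Real.exp_zero, mul_one] at h0
  have h1 : ‖x 0 - y 0‖ ^ 2 ≤ 0 :=
    h0.trans (mul_nonpos_of_nonpos_of_nonneg hS (Real.exp_pos _).le)
  have h2 : ‖x 0 - y 0‖ = 0 := by
    have := sq_nonneg ‖x 0 - y 0‖
    exact pow_eq_zero_iff two_ne_zero |>.1 (le_antisymm h1 this)
  exact sub_eq_zero.1 (norm_eq_zero.1 h2)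

/-- Exponential convergence to `e` of solutions that stay away from `-e`. -/
lemma IsSphereSolution.norm_sub_sq_le {δ ρ : ℝ} (hγ : 0 < γ) (he : ‖e‖ = 1)
    (hx : IsSphereSolution γ (fun t => e - u t) x)
    (hu : ∀ t : ℝ, 0 ≤ t → ‖u t‖ ≤ N * Real.exp (-β * t)) (hδ : 0 < δ)
    (hxδ : ∀ t : ℝ, 0 ≤ t → δ ≤ 1 + ⟪e, x t⟫) (hρ : 2 * ρ ≤ γ * δ / 2) (hρβ : ρ < β)
    {t : ℝ} (ht : 0 ≤ t) :
    ‖e - x t‖ ^ 2 ≤ (‖e - x 0‖ ^ 2 + γ * N ^ 2 / (δ * (β - ρ))) * Real.exp (-(2 * ρ) * t) := by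
  set K := γ * N ^ 2 / (δ * (β - ρ)) with hK
  have hβρ : 0 < β - ρ := by linarith
  have hK0 : 0 ≤ K := by positivity
  -- Energy `‖e - x‖ ^ 2 * exp (2 ρ t)` plus a decaying term. `K` is chosen so that the derivative
  -- of that term cancels the part of the perturbation left over by Young's inequality.
  have hG := antitoneOn_of_hasDerivWithinAt_Ici
    (g := fun s => 2 * (1 - ⟪e, x s⟫) * Real.exp (- -(2 * ρ) * s)
      + K * Real.exp (-(2 * (β - ρ)) * s))
    (fun t ht => ((((hx.hasDerivWithinAt_inner he ht).const_sub 1).const_mul 2).mul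
      (hasDerivAt_exp_neg_mul (-(2 * ρ)) t).hasDerivWithinAt).add
      ((hasDerivAt_exp_neg_mul (2 * (β - ρ)) t).hasDerivWithinAt.const_mul K))
    (fun t ht => by
      have herr := neg_abs_le (⟪e, u t⟫ - ⟪x t, u t⟫ * ⟪e, x t⟫)
      have herr2 := abs_inner_sub_mul_inner_le (w := u t) he (hx t ht).1
      have hs0 := Real.sqrt_nonneg (1 - ⟪e, x t⟫ ^ 2)
      have hs2 := Real.sq_sqrt (one_sub_inner_sq_nonneg he (hx t ht).1)
      have hh := (abs_le.1 (abs_inner_le_one he (hx t ht).1)).2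
      have hδt := hxδ t ht
      have hut := hu t ht
      have hun := norm_nonneg (u t)
      set r := ⟪e, u t⟫ - ⟪x t, u t⟫ * ⟪e, x t⟫
      set s := √(1 - ⟪e, x t⟫ ^ 2)
      set h := ⟪e, x t⟫
      set w := ‖u t‖
      have hexp : Real.exp (-(2 * (β - ρ)) * t)
          = Real.exp (- -(2 * ρ) * t) * (Real.exp (-β * t)) ^ 2 := by
        rw [← Real.exp_nat_mul, ← Real.exp_add]; congr 1; push_cast; ring
      have hw2 : w ^ 2 ≤ N ^ 2 * Real.exp (-β * t) ^ 2 := by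
        rw [← mul_pow]; exact pow_le_pow_left₀ hun hut 2
      have hKe : K * (2 * (β - ρ)) = 2 * γ / δ * N ^ 2 := by
        rw [hK]; field_simp
      -- The weight `δ / 2` spends half of the damping on the perturbation; the other half, `γ δ /
      -- 2`, must dominate `2 ρ`.
      have hyoung : 2 * (s * w) ≤ δ / 2 * s ^ 2 + 2 / δ * w ^ 2 := by
        have h1 : δ / 2 * s ^ 2 + 2 / δ * w ^ 2 - 2 * (s * w) = (δ * s - 2 * w) ^ 2 / (2 * δ) := by
          field_simp; ring
        have : 0 ≤ (δ * s - 2 * w) ^ 2 / (2 * δ) := by positivity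
        linarith
      have hs3 : s ^ 2 ≤ 2 * (1 - h) := by nlinarith
      have hmain : -(2 * (γ * ((1 - h ^ 2) - r))) + 2 * ρ * (2 * (1 - h))
          ≤ 2 * γ / δ * N ^ 2 * Real.exp (-β * t) ^ 2 := by
        have h1 : 2 * (γ * r) ≤ γ * (2 * (s * w)) := by
          have := le_abs_self r
          nlinarith
        have h2 : γ * (2 * (s * w)) ≤ γ * (δ / 2 * (2 * (1 - h)) + 2 / δ * w ^ 2) := by
          gcongr
          refine hyoung.trans ?_
          gcongr
        have h3 : 2 * ρ * (2 * (1 - h)) ≤ γ * δ / 2 * (2 * (1 - h)) :=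
          mul_le_mul_of_nonneg_right hρ (by linarith)
        have h4 : γ * (2 * (1 - h) * δ) ≤ γ * (2 * (1 - h) * (1 + h)) := by
          refine mul_le_mul_of_nonneg_left (mul_le_mul_of_nonneg_left hδt (by linarith)) hγ.le
        have h5 : 2 * γ / δ * w ^ 2 ≤ 2 * γ / δ * (N ^ 2 * Real.exp (-β * t) ^ 2) := by gcongr
        have h6 : γ * (2 / δ * w ^ 2) = 2 * γ / δ * w ^ 2 := by ring
        nlinarith
      have hE := Real.exp_pos (- -(2 * ρ) * t)
      rw [hexp]
      set E1 := Real.exp (- -(2 * ρ) * t)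
      set E2 := Real.exp (-β * t)
      have key := mul_le_mul_of_nonneg_right hmain hE.le
      have h7 : K * (-(2 * (β - ρ)) * (E1 * E2 ^ 2)) = -(2 * γ / δ * N ^ 2 * E2 ^ 2 * E1) := by
        rw [← hKe]; ring
      rw [h7]
      linarith)
  have h := hG (self_mem_Ici : (0 : ℝ) ∈ Ici 0) ht ht
  rw [norm_sub_sq_eq_of_norm_one he (hx t ht).1, norm_sub_sq_eq_of_norm_one he (hx 0 le_rfl).1]
  simp only [mul_zero, Real.exp_zero, mul_one] at h
  have h1 : 0 ≤ K * Real.exp (-(2 * (β - ρ)) * t) := by positivity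
  have h2 : 2 * (1 - ⟪e, x t⟫) * Real.exp (- -(2 * ρ) * t) ≤ 2 * (1 - ⟪e, x 0⟫) + K := by linarith
  calc 2 * (1 - ⟪e, x t⟫)
      = 2 * (1 - ⟪e, x t⟫) * Real.exp (- -(2 * ρ) * t) * Real.exp (-(2 * ρ) * t) := by
        rw [mul_assoc, ← Real.exp_add]; simp
    _ ≤ _ := by gcongr

end Sphere

/-! ### The error field: regularity, global trajectories, equilibria -/

section Field

open scoped RealInnerProductSpace

variable {n : ℕ} {ez : E3} {α : Fin n → ℝ} {γ : ℝ}

lemma skewSq_eq (u w : E3) : skewSq u w = ⟪u, w⟫ • u - ⟪u, u⟫ • w := by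
  rw [real_inner_self_eq_norm_sq, EuclideanSpace.real_norm_sq_eq]
  ext i
  fin_cases i <;>
  simp [skewSq, skew, PiLp.inner_apply, Fin.sum_univ_three, dotProduct, sq] <;> ring

lemma inner_skewSq_self (u w : E3) : ⟪u, skewSq u w⟫ = 0 := by
  rw [skewSq_eq, inner_sub_right, real_inner_smul_right, real_inner_smul_right]
  ring

lemma errorField_eq [NeZero n] (ξ : State n) : errorField ez α γ ξ =
    (chain α ξ.1, γ • skewSq (ez - ξ.2) (ξ.2 - ξ.1 0)) := rfl

lemma contDiff_chain : ContDiff ℝ 1 (chain α : (Fin n → E3) → Fin n → E3) := by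
  rw [contDiff_pi]
  intro i
  simp only [chain]
  split_ifs
  · fun_prop
  · fun_prop

lemma contDiff_errorField [NeZero n] : ContDiff ℝ 1 (errorField ez α γ) := by
  have h : errorField ez α γ = fun ξ : State n => (chain α ξ.1, γ • (⟪ez - ξ.2, ξ.2 - ξ.1 0⟫ •
      (ez - ξ.2) - ⟪ez - ξ.2, ez - ξ.2⟫ • (ξ.2 - ξ.1 0))) := by
    ext1 ξ
    rw [errorField_eq, skewSq_eq]
  rw [h]
  refine (contDiff_chain.comp contDiff_fst).prodMk ?_
  have h1 : ContDiff ℝ 1 fun ξ : State n => ez - ξ.2 := by fun_prop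
  have h2 : ContDiff ℝ 1 fun ξ : State n => ξ.2 - ξ.1 0 := by fun_prop
  exact (((h1.inner ℝ h2).smul h1).sub ((h1.inner ℝ h1).smul h2)).const_smul γ

lemma mem_upsilon {ξ : State n} : ξ ∈ upsilon n ez ↔ ‖ez - ξ.2‖ = 1 := by
  simp [upsilon, shiftedSphere]

lemma IsTrajectory.isChainSolution [NeZero n] {ξ : ℝ → State n}
    (hξ : IsTrajectory (errorField ez α γ) (upsilon n ez) ξ) :
    IsChainSolution α (fun t => (ξ t).1) := fun t ht =>
  (ContinuousLinearMap.fst ℝ (Fin n → E3) E3).hasFDerivAt.comp_hasDerivWithinAt t (hξ t ht).2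

lemma IsTrajectory.isSphereSolution [NeZero n] {ξ : ℝ → State n}
    (hξ : IsTrajectory (errorField ez α γ) (upsilon n ez) ξ) :
    IsSphereSolution γ (fun t => ez - (ξ t).1 0) (fun t => ez - (ξ t).2) := by
  intro t ht
  have h1 : ‖ez - (ξ t).2‖ = 1 := mem_upsilon.1 (hξ t ht).1
  refine ⟨h1, ?_⟩
  have h2 := ((ContinuousLinearMap.snd ℝ (Fin n → E3) E3).hasFDerivAt.comp_hasDerivWithinAt t
    (hξ t ht).2).const_sub ez
  refine h2.congr_deriv ?_
  have h3 : (ξ t).2 - (ξ t).1 0 = (ez - (ξ t).1 0) - (ez - (ξ t).2) := by abel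
  simp only [ContinuousLinearMap.coe_snd', errorField_eq, skewSq_eq]
  rw [h3, inner_sub_right, real_inner_self_eq_norm_sq, h1]
  module

lemma norm_chain_le (ψ : Fin n → E3) : ‖chain α ψ‖ ≤ (1 + ∑ j, |α j|) * ‖ψ‖ := by
  have hs : 0 ≤ ∑ j, |α j| := Finset.sum_nonneg fun _ _ => abs_nonneg _
  rw [pi_norm_le_iff_of_nonneg (by positivity)]
  intro i
  simp only [chain]
  split_ifs
  · refine (norm_le_pi_norm ψ _).trans ?_
    nlinarith [norm_nonneg ψ]
  · rw [norm_neg]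
    calc ‖∑ j, α j • ψ j‖ ≤ ∑ j, |α j| * ‖ψ‖ := by
          refine norm_sum_le_of_le _ fun j _ => ?_
          rw [norm_smul, Real.norm_eq_abs]
          gcongr
          exact norm_le_pi_norm ψ j
      _ = (∑ j, |α j|) * ‖ψ‖ := by rw [Finset.sum_mul]
      _ ≤ _ := by nlinarith [norm_nonneg ψ]

/-- The sphere is invariant under all fields proportional to the error field. -/
lemma norm_sub_snd_eq_of_hasDerivWithinAt [NeZero n] {χ : ℝ → ℝ} {ξ : ℝ → State n} {T : ℝ}
    (hξ : ∀ t ∈ Icc 0 T, HasDerivWithinAt ξ (χ t • errorField ez α γ (ξ t)) (Icc 0 T) t)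
    {t : ℝ} (ht : t ∈ Icc 0 T) : ‖ez - (ξ t).2‖ = ‖ez - (ξ 0).2‖ := by
  have hd : ∀ t ∈ Icc 0 T, HasDerivWithinAt (fun s => ‖ez - (ξ s).2‖ ^ 2) 0 (Icc 0 T) t := by
    intro t ht
    have h2 := (((ContinuousLinearMap.snd ℝ (Fin n → E3) E3).hasFDerivAt.comp_hasDerivWithinAt t
      (hξ t ht)).const_sub ez).norm_sq
    refine h2.congr_deriv ?_
    simp only [ContinuousLinearMap.coe_snd', errorField_eq, Prod.smul_snd, Function.comp_apply,
      inner_neg_right, real_inner_smul_right, inner_skewSq_self]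
    ring
  have h := constant_of_has_deriv_right_zero (fun s hs => (hd s hs).continuousWithinAt)
    (fun s hs => ((hd s (Ico_subset_Icc_self hs)).mono
      (Icc_subset_Icc_left hs.1)).mono_of_mem_nhdsWithin (Icc_mem_nhdsGE hs.2)) t ht
  exact (pow_left_inj₀ (norm_nonneg _) (norm_nonneg _) two_ne_zero).1 h

lemma norm_fst_le_of_hasDerivWithinAt [NeZero n] {χ : ℝ → ℝ} (hχ : ∀ t, χ t ∈ Icc (0 : ℝ) 1)
    {ξ : ℝ → State n} {T : ℝ}
    (hξ : ∀ t ∈ Icc 0 T, HasDerivWithinAt ξ (χ t • errorField ez α γ (ξ t)) (Icc 0 T) t)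
    {t : ℝ} (ht : t ∈ Icc 0 T) :
    ‖(ξ t).1‖ ≤ ‖(ξ 0).1‖ * Real.exp ((1 + ∑ j, |α j|) * T) := by
  have hd : ∀ t ∈ Icc 0 T,
      HasDerivWithinAt (fun s => (ξ s).1) (χ t • chain α (ξ t).1) (Icc 0 T) t := fun t ht =>
    (ContinuousLinearMap.fst ℝ (Fin n → E3) E3).hasFDerivAt.comp_hasDerivWithinAt t (hξ t ht)
  have h := norm_le_gronwallBound_of_norm_deriv_right_le
    (fun s hs => (hd s hs).continuousWithinAt)
    (fun s hs => ((hd s (Ico_subset_Icc_self hs)).mono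
      (Icc_subset_Icc_left hs.1)).mono_of_mem_nhdsWithin (Icc_mem_nhdsGE hs.2)) le_rfl
    (K := 1 + ∑ j, |α j|) (ε := 0) (fun s _ => by
      rw [norm_smul, Real.norm_of_nonneg (hχ s).1, add_zero]
      exact (mul_le_of_le_one_left (norm_nonneg _) (hχ s).2).trans (norm_chain_le _)) t ht
  rw [gronwallBound_ε0, sub_zero] at h
  have hs : 0 ≤ ∑ j, |α j| := Finset.sum_nonneg fun _ _ => abs_nonneg _
  refine h.trans ?_
  gcongr
  exact ht.2

lemma norm_snd_le_two {z : E3} (hez : ‖ez‖ = 1) (hz : ‖ez - z‖ = 1) : ‖z‖ ≤ 2 := by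
  have h : z = ez - (ez - z) := by abel
  rw [h]
  refine (norm_sub_le _ _).trans ?_
  rw [hez, hz]; norm_num

lemma exists_trajectory [NeZero n] (hez : ‖ez‖ = 1) (x : State n) (hx : x ∈ upsilon n ez) :
    ∃ ξ : ℝ → State n, IsTrajectory (errorField ez α γ) (upsilon n ez) ξ ∧ ξ 0 = x := by
  obtain ⟨ξ, hξ0, hξ⟩ := exists_solution_of_cutoff_bound
    -- The chain grows at most exponentially by Grönwall, and `z₂` stays on its sphere because
    -- `S(u)² w` is orthogonal to `u`; a factor `χ` with values in `[0, 1]` spoils neither bound.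
    (contDiff_errorField (ez := ez) (α := α) (γ := γ)) x (fun T hT =>
      ⟨max (‖x.1‖ * Real.exp ((1 + ∑ j, |α j|) * T)) 2, fun χ ξ hξ0 hχ hξ t ht => by
        rw [Prod.norm_def]
        refine max_le_max ?_ ?_
        · rw [← hξ0]
          exact norm_fst_le_of_hasDerivWithinAt hχ hξ ht
        · refine norm_snd_le_two hez ?_
          rw [norm_sub_snd_eq_of_hasDerivWithinAt hξ ht, hξ0]
          exact mem_upsilon.1 hx⟩)
  refine ⟨ξ, fun t ht => ⟨?_, hξ t ht⟩, hξ0⟩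
  rw [mem_upsilon, norm_sub_snd_eq_of_hasDerivWithinAt (ξ := ξ) (χ := fun _ => 1) (T := t)
    (fun s hs => by rw [one_smul]; exact (hξ s hs.1).mono Icc_subset_Ici_self) ⟨ht, le_rfl⟩, hξ0]
  exact mem_upsilon.1 hx

lemma equilibria_eq [NeZero n] (hez : ‖ez‖ = 1) (hα : ∀ i, 0 < α i) (hγ : 0 < γ) :
    {ξ ∈ upsilon n ez | errorField ez α γ ξ = 0} =
      {((0 : Fin n → E3), (0 : E3)), (0, (2 : ℝ) • ez)} := by
  ext ⟨ψ, z⟩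
  simp only [mem_ofPred_eq, mem_upsilon, mem_insert_iff, mem_singleton_iff, Prod.mk.injEq,
    errorField_eq, Prod.mk_eq_zero, smul_eq_zero, hγ.ne', false_or]
  constructor
  · rintro ⟨h1, h2, h3⟩
    have hsucc : ∀ i : Fin n, i ≠ 0 → ψ i = 0 := by
      intro i hi
      have hi0 : (i : ℕ) ≠ 0 := fun h => hi (Fin.ext (by simpa using h))
      have := congrFun h2 ⟨(i : ℕ) - 1, by omega⟩
      have hlt : (i : ℕ) - 1 + 1 < n := by omega
      simp only [chain, hlt, dif_pos, Pi.zero_apply] at this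
      rw [← this]
      congr 1
      exact Fin.ext (by simp; omega)
    have hψ : ψ = 0 := by
      have hn : 0 < n := Nat.pos_of_ne_zero (NeZero.ne n)
      have := congrFun h2 ⟨n - 1, by omega⟩
      have hlt : ¬ (n - 1 + 1 < n) := by omega
      simp only [chain, hlt, dif_neg, not_false_eq_true, Pi.zero_apply, neg_eq_zero] at this
      rw [Finset.sum_eq_single_of_mem 0 (Finset.mem_univ _)
        (fun j _ hj => by rw [hsucc j hj, smul_zero]), smul_eq_zero] at this
      ext1 i
      by_cases hi : i = 0
      · rw [hi]; exact this.resolve_left (hα 0).ne'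
      · exact hsucc i hi
    subst hψ
    simp only [true_and]
    rw [skewSq_eq, real_inner_self_eq_norm_sq, h1, one_pow, one_smul, Pi.zero_apply, sub_zero,
      sub_eq_zero] at h3
    -- `h3` makes `z`, hence `e_z`, a multiple of `e_z - z`; both are unit vectors, so the factor `1
    -- + c` is `1` or `-1`.
    set c := ⟪ez - z, z⟫
    have h4 : ez = (1 + c) • (ez - z) := by
      rw [add_smul, one_smul, h3]; abel
    have h5 : |1 + c| = 1 := by
      have := congrArg norm h4
      rwa [hez, norm_smul, h1, mul_one, Real.norm_eq_abs, eq_comm] at this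
    rcases eq_or_eq_neg_of_abs_eq h5 with h | h
    · left
      rw [h, one_smul] at h4
      exact sub_eq_self.1 h4.symm
    · right
      rw [h] at h4
      rw [two_smul]
      have : z - (ez + ez) = - (ez - (-1 : ℝ) • (ez - z)) := by module
      rw [← sub_eq_zero, this, ← h4, sub_self, neg_zero]
  · have hchain : chain α (0 : Fin n → E3) = 0 := by
      ext1 i
      simp only [chain, Pi.zero_apply, smul_zero, Finset.sum_const_zero, neg_zero, dite_eq_ite,
        ite_self]
    rintro (⟨rfl, rfl⟩ | ⟨rfl, rfl⟩)
    · refine ⟨by simpa using hez, hchain, ?_⟩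
      simp [skewSq_eq]
    · have h : ez - (2 : ℝ) • ez = -ez := by module
      refine ⟨by rw [h, norm_neg, hez], hchain, ?_⟩
      rw [h, skewSq_eq, Pi.zero_apply, sub_zero, real_inner_smul_right, inner_neg_left,
        inner_neg_left, inner_neg_right, real_inner_self_eq_norm_sq, hez]
      module

/-- Twice this quantity is `‖e_z + (e_z - z₂)‖ ^ 2`, which vanishes only at `z₂ = 2 e_z`. -/
lemma one_add_inner_pos_of_mem_upsilonStar (hez : ‖ez‖ = 1) {ξ : State n}
    (hξ : ξ ∈ upsilonStar n ez) : 0 < 1 + ⟪ez, ez - ξ.2⟫ := by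
  have hx : ‖ez - ξ.2‖ = 1 := by simpa [shiftedSphere] using hξ.2.1
  have h := norm_sub_sq_eq_of_norm_one hez (x := -(ez - ξ.2)) (by rw [norm_neg, hx])
  have hne : ez - -(ez - ξ.2) ≠ 0 := by
    intro h0
    refine hξ.2.2 ?_
    rw [mem_singleton_iff, ← sub_eq_zero, ← neg_eq_zero, ← h0]
    module
  have hpos : 0 < ‖ez - -(ez - ξ.2)‖ ^ 2 := by positivity
  rw [h, inner_neg_right] at hpos
  linarith

end Field

/-! ### Stability, basin of attraction and choice of gains -/

section Stability

open scoped RealInnerProductSpace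

variable {n : ℕ} [NeZero n] {ez : E3} {α : Fin n → ℝ} {γ β M : ℝ}

/-- Uniform exponential decay of the solutions of the chain of integrators. -/
def ChainDecay (α : Fin n → ℝ) (β M : ℝ) : Prop :=
  ∀ ψ, IsChainSolution α ψ → ∀ t : ℝ, 0 ≤ t → ‖ψ t‖ ≤ M * ‖ψ 0‖ * Real.exp (-β * t)

lemma ChainDecay.norm_zero_le (h : ChainDecay α β M) {ψ : ℝ → Fin n → E3}
    (hψ : IsChainSolution α ψ) (t : ℝ) (ht : 0 ≤ t) :
    ‖ψ t 0‖ ≤ M * ‖ψ 0‖ * Real.exp (-β * t) :=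
  (norm_le_pi_norm (ψ t) 0).trans (h ψ hψ t ht)

lemma norm_snd_sq_eq (hez : ‖ez‖ = 1) {z : E3} (hz : ‖ez - z‖ = 1) :
    ‖z‖ ^ 2 = 2 * (1 - ⟪ez, ez - z⟫) := by
  rw [← norm_sub_sq_eq_of_norm_one hez hz]
  congr 2
  abel

lemma tendsto_of_inner_tendsto_one (hez : ‖ez‖ = 1) {z : ℝ → E3}
    (hz : ∀ t : ℝ, 0 ≤ t → ‖ez - z t‖ = 1)
    (h : Tendsto (fun t => ⟪ez, ez - z t⟫) atTop (𝓝 1)) : Tendsto z atTop (𝓝 0) := by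
  rw [tendsto_zero_iff_norm_tendsto_zero]
  have h1 : Tendsto (fun t => √(2 * (1 - ⟪ez, ez - z t⟫))) atTop (𝓝 0) := by
    have := ((h.const_sub 1).const_mul 2).sqrt
    simpa using this
  refine h1.congr' ?_
  filter_upwards [eventually_ge_atTop 0] with t ht
  rw [← norm_snd_sq_eq hez (hz t ht), Real.sqrt_sq (norm_nonneg _)]

lemma tendsto_of_inner_tendsto_neg_one (hez : ‖ez‖ = 1) {z : ℝ → E3}
    (hz : ∀ t : ℝ, 0 ≤ t → ‖ez - z t‖ = 1)
    (h : Tendsto (fun t => ⟪ez, ez - z t⟫) atTop (𝓝 (-1))) :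
    Tendsto z atTop (𝓝 ((2 : ℝ) • ez)) := by
  -- The antipodal map `z ↦ 2 e_z - z` of the shifted sphere exchanges the two limits.
  have hneg : ∀ t, ez - ((2 : ℝ) • ez - z t) = -(ez - z t) := fun t => by module
  have h1 : Tendsto (fun t => (2 : ℝ) • ez - z t) atTop (𝓝 0) := by
    refine tendsto_of_inner_tendsto_one hez (fun t ht => ?_) ?_
    · rw [hneg, norm_neg, hz t ht]
    · simp only [hneg, inner_neg_right]
      simpa using h.neg
  simpa using h1.const_sub ((2 : ℝ) • ez)

lemma IsTrajectory.tendsto_fst (hβ : 0 < β) (hdecay : ChainDecay α β M) {ξ : ℝ → State n}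
    (hξ : IsTrajectory (errorField ez α γ) (upsilon n ez) ξ) :
    Tendsto (fun t => (ξ t).1) atTop (𝓝 0) := by
  refine squeeze_zero_norm' (a := fun t => M * ‖(ξ 0).1‖ * Real.exp (-β * t)) ?_ ?_
  · filter_upwards [eventually_ge_atTop 0] with t ht
    exact hdecay _ hξ.isChainSolution t ht
  · simpa using (tendsto_exp_neg_mul_atTop hβ).const_mul (M * ‖(ξ 0).1‖)

lemma IsTrajectory.tendsto_or (hez : ‖ez‖ = 1) (hγ : 0 < γ) (hβ : 0 < β)
    (hdecay : ChainDecay α β M) {ξ : ℝ → State n}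
    (hξ : IsTrajectory (errorField ez α γ) (upsilon n ez) ξ) :
    Tendsto ξ atTop (𝓝 (0, 0)) ∨ Tendsto ξ atTop (𝓝 (0, (2 : ℝ) • ez)) := by
  have hsph := hξ.isSphereSolution
  have hfst := hξ.tendsto_fst hβ hdecay
  rcases hsph.tendsto_inner hγ hβ hez (hdecay.norm_zero_le hξ.isChainSolution) with h | h
  · exact Or.inl (hfst.prodMk_nhds
      (tendsto_of_inner_tendsto_one hez (fun t ht => (hsph t ht).1) h))
  · exact Or.inr (hfst.prodMk_nhds
      (tendsto_of_inner_tendsto_neg_one hez (fun t ht => (hsph t ht).1) h))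

lemma IsTrajectory.le_inner (hez : ‖ez‖ = 1) (hγ : 0 < γ) (hβ : 0 < β)
    (hdecay : ChainDecay α β M) {ξ : ℝ → State n}
    (hξ : IsTrajectory (errorField ez α γ) (upsilon n ez) ξ) {s t : ℝ} (hs : 0 ≤ s)
    (hst : s ≤ t) :
    ⟪ez, ez - (ξ s).2⟫ - γ * M / β * ‖(ξ 0).1‖ * Real.exp (-β * s) ≤ ⟪ez, ez - (ξ t).2⟫ := by
  have h := hξ.isSphereSolution.le_inner hγ hβ hez
    (hdecay.norm_zero_le hξ.isChainSolution) hs hst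
  have h2 : γ * (M * ‖(ξ 0).1‖) / β = γ * M / β * ‖(ξ 0).1‖ := by ring
  rwa [h2] at h

lemma isLyapunovStable_errorField (hez : ‖ez‖ = 1) (hγ : 0 < γ) (hβ : 0 < β) (hM : 0 ≤ M)
    (hdecay : ChainDecay α β M) :
    IsLyapunovStable (errorField ez α γ) (upsilon n ez) (0, 0) := by
  intro ε hε
  set c := γ * M / β with hc
  have hc0 : 0 ≤ c := by positivity
  -- As `‖z₂‖ ^ 2 = 2 (1 - h)`, the height bound gives `‖z₂(t)‖ ^ 2 ≤ ‖z₂(0)‖ ^ 2 + 2 c ‖ξ(0)‖`, at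
  -- most `(1 + 2 c) ‖ξ(0)‖` once `‖ξ(0)‖ ≤ 1`. The last entry controls the chain.
  refine ⟨min 1 (min (ε ^ 2 / (1 + 2 * c)) (ε / (M + 1))), by positivity,
    fun ξ hξ h0 t ht => ?_⟩
  simp only [Prod.mk_zero_zero, sub_zero] at h0 ⊢
  obtain ⟨h1, h2⟩ := lt_min_iff.1 h0
  obtain ⟨h2, h3⟩ := lt_min_iff.1 h2
  rw [lt_div_iff₀ (by positivity)] at h2 h3
  have hfst : ‖(ξ 0).1‖ ≤ ‖ξ 0‖ := norm_fst_le _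
  have hsnd : ‖(ξ 0).2‖ ≤ ‖ξ 0‖ := norm_snd_le _
  have hn0 := norm_nonneg (ξ 0)
  rw [Prod.norm_def, max_lt_iff]
  constructor
  · have h4 := hdecay _ hξ.isChainSolution t ht
    have h5 : Real.exp (-β * t) ≤ 1 := Real.exp_le_one_iff.2 (by nlinarith)
    have h6 : M * ‖(ξ 0).1‖ * Real.exp (-β * t) ≤ M * ‖(ξ 0).1‖ :=
      mul_le_of_le_one_right (by positivity) h5
    have h7 : M * ‖(ξ 0).1‖ ≤ M * ‖ξ 0‖ := by gcongr
    nlinarith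
  · have h4 := hξ.le_inner hez hγ hβ hdecay le_rfl ht
    simp only [mul_zero, Real.exp_zero, mul_one] at h4
    have h5 := norm_snd_sq_eq hez (mem_upsilon.1 (hξ 0 le_rfl).1)
    have h6 := norm_snd_sq_eq hez (mem_upsilon.1 (hξ t ht).1)
    have h7 : c * ‖(ξ 0).1‖ ≤ c * ‖ξ 0‖ := by gcongr
    have h8 : ‖(ξ 0).2‖ ^ 2 ≤ ‖ξ 0‖ := by nlinarith [norm_nonneg (ξ 0).2]
    refine lt_of_pow_lt_pow_left₀ 2 hε.le ?_
    nlinarith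

/-- Two amplitudes are kept apart: `M'` for the whole chain, which may peak when the gains are
large, and `M` for its first block, the only one entering the sphere estimate. -/
lemma IsTrajectory.norm_le {M' δ ρ : ℝ} (hez : ‖ez‖ = 1) (hγ : 0 < γ) (hM' : 0 ≤ M')
    {ξ : ℝ → State n} (hξ : IsTrajectory (errorField ez α γ) (upsilon n ez) ξ)
    (hψ : ∀ t : ℝ, 0 ≤ t → ‖(ξ t).1‖ ≤ M' * ‖(ξ 0).1‖ * Real.exp (-β * t))
    (hu : ∀ t : ℝ, 0 ≤ t → ‖(ξ t).1 0‖ ≤ M * ‖(ξ 0).1‖ * Real.exp (-β * t)) (hδ : 0 < δ)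
    (hξδ : ∀ t : ℝ, 0 ≤ t → δ ≤ 1 + ⟪ez, ez - (ξ t).2⟫) (hρ : 2 * ρ ≤ γ * δ / 2) (hρβ : ρ < β)
    {t : ℝ} (ht : 0 ≤ t) :
    ‖ξ t‖ ≤ (M' + (1 + γ * M ^ 2 / (δ * (β - ρ)))) * ‖ξ 0‖ * Real.exp (-ρ * t) := by
  have hβρ : 0 < β - ρ := by linarith
  set K := γ * M ^ 2 / (δ * (β - ρ)) with hK
  have hK0 : 0 ≤ K := by positivity
  have hfst : ‖(ξ 0).1‖ ≤ ‖ξ 0‖ := norm_fst_le _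
  have hsnd : ‖(ξ 0).2‖ ≤ ‖ξ 0‖ := norm_snd_le _
  have hexp : Real.exp (-β * t) ≤ Real.exp (-ρ * t) := Real.exp_le_exp.2 (by nlinarith)
  rw [Prod.norm_def]
  refine max_le ?_ ?_
  · calc ‖(ξ t).1‖ ≤ M' * ‖(ξ 0).1‖ * Real.exp (-β * t) := hψ t ht
      _ ≤ M' * ‖ξ 0‖ * Real.exp (-ρ * t) := by gcongr
      _ ≤ _ := by gcongr; linarith
  · have h := hξ.isSphereSolution.norm_sub_sq_le hγ hez hu hδ hξδ hρ hρβ ht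
    simp only [sub_sub_cancel] at h
    have h1 : γ * (M * ‖(ξ 0).1‖) ^ 2 / (δ * (β - ρ)) = K * ‖(ξ 0).1‖ ^ 2 := by rw [hK]; ring
    rw [h1] at h
    have h2 : Real.exp (-(2 * ρ) * t) = Real.exp (-ρ * t) ^ 2 := by
      rw [← Real.exp_nat_mul]; congr 1; push_cast; ring
    have h3 : ‖(ξ t).2‖ ≤ (1 + K) * ‖ξ 0‖ * Real.exp (-ρ * t) := by
      refine le_of_sq_le_sq ?_ (by positivity)
      calc ‖(ξ t).2‖ ^ 2 ≤ (‖(ξ 0).2‖ ^ 2 + K * ‖(ξ 0).1‖ ^ 2) * Real.exp (-(2 * ρ) * t) := h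
        _ ≤ (‖ξ 0‖ ^ 2 + K * ‖ξ 0‖ ^ 2) * Real.exp (-ρ * t) ^ 2 := by rw [h2]; gcongr
        _ = (1 + K) * (‖ξ 0‖ ^ 2 * Real.exp (-ρ * t) ^ 2) := by ring
        _ ≤ (1 + K) ^ 2 * (‖ξ 0‖ ^ 2 * Real.exp (-ρ * t) ^ 2) := by
          gcongr
          exact le_self_pow₀ (by linarith) two_ne_zero
        _ = _ := by ring
    refine h3.trans ?_
    rw [mul_assoc, mul_assoc]
    exact mul_le_mul_of_nonneg_right (le_add_of_nonneg_left hM') (by positivity)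

lemma isLocallyExponentiallyStable_errorField (hez : ‖ez‖ = 1) (hγ : 0 < γ) (hβ : 0 < β)
    (hM : 0 ≤ M) (hdecay : ChainDecay α β M) :
    IsLocallyExponentiallyStable (errorField ez α γ) (upsilon n ez) (0, 0) := by
  set c := γ * M / β with hc
  have hc0 : 0 ≤ c := by positivity
  have hρ0 : 0 < min (γ / 4) (β / 2) := by positivity
  have hρ1 : min (γ / 4) (β / 2) ≤ γ / 4 := min_le_left _ _
  have hρ2 : min (γ / 4) (β / 2) ≤ β / 2 := min_le_right _ _
  set ρ := min (γ / 4) (β / 2)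
  have hβρ : 0 < β - ρ := by linarith
  -- In this ball the initial height is at least `1 / 2` and the loss is less than `1 / 2`, so the
  -- height stays nonnegative and `δ = 1` is available; this permits `ρ ≤ γ / 4`.
  refine ⟨min 1 (1 / (2 * (c + 1))), by positivity, ρ, hρ0,
    M + (1 + γ * M ^ 2 / (1 * (β - ρ))), by positivity, fun ξ hξ h0 t ht => ?_⟩
  simp only [Metric.mem_ball, dist_eq_norm, Prod.mk_zero_zero, sub_zero] at h0 ⊢
  obtain ⟨h1, h2⟩ := lt_min_iff.1 h0
  rw [lt_div_iff₀ (by positivity)] at h2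
  refine hξ.norm_le hez hγ hM (hdecay _ hξ.isChainSolution)
    (hdecay.norm_zero_le hξ.isChainSolution) one_pos (fun s hs => ?_) (by linarith)
    (by linarith) ht
  have h4 := hξ.le_inner hez hγ hβ hdecay le_rfl hs
  simp only [mul_zero, Real.exp_zero, mul_one] at h4
  have h5 := norm_snd_sq_eq hez (mem_upsilon.1 (hξ 0 le_rfl).1)
  have hfst : ‖(ξ 0).1‖ ≤ ‖ξ 0‖ := norm_fst_le _
  have hsnd : ‖(ξ 0).2‖ ≤ ‖ξ 0‖ := norm_snd_le _
  have h7 : c * ‖(ξ 0).1‖ ≤ c * ‖ξ 0‖ := by gcongr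
  have h8 : ‖(ξ 0).2‖ ^ 2 ≤ 1 := by nlinarith [norm_nonneg (ξ 0).2]
  nlinarith [norm_nonneg (ξ 0)]

/-- The set of initial points whose trajectory converges to the origin. -/
def basin (ez : E3) (α : Fin n → ℝ) (γ : ℝ) : Set (upsilon n ez) :=
  {p | ∃ ξ : ℝ → State n, IsTrajectory (errorField ez α γ) (upsilon n ez) ξ ∧ ξ 0 = p ∧
    Tendsto ξ atTop (𝓝 (0, 0))}

lemma IsTrajectory.norm_le_max (hez : ‖ez‖ = 1) (hβ : 0 < β) (hM : 0 ≤ M)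
    (hdecay : ChainDecay α β M) {ξ : ℝ → State n}
    (hξ : IsTrajectory (errorField ez α γ) (upsilon n ez) ξ) {t : ℝ} (ht : 0 ≤ t) :
    ‖ξ t‖ ≤ max (M * ‖ξ 0‖) 2 := by
  rw [Prod.norm_def]
  refine max_le_max ?_ (norm_snd_le_two hez (mem_upsilon.1 (hξ t ht).1))
  refine (hdecay _ hξ.isChainSolution t ht).trans ?_
  have h5 : Real.exp (-β * t) ≤ 1 := Real.exp_le_one_iff.2 (by nlinarith)
  refine (mul_le_of_le_one_right (by positivity) h5).trans ?_
  gcongr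
  exact norm_fst_le _

lemma isOpen_basin (hez : ‖ez‖ = 1) (hγ : 0 < γ) (hβ : 0 < β) (hM : 0 ≤ M)
    (hdecay : ChainDecay α β M) : IsOpen (basin ez α γ) := by
  rw [Metric.isOpen_iff]
  rintro p ⟨ξ, hξ, hξ0, hlim⟩
  set c := γ * M / β with hc
  have hc0 : 0 ≤ c := by positivity
  have hz : Tendsto (fun t => (ξ t).2) atTop (𝓝 0) := (continuous_snd.tendsto _).comp hlim
  -- Convergence to the origin is detected at a finite time: once this quantity exceeds `-1` at some
  -- `T`, `IsTrajectory.le_inner` keeps the height away from `-1` for ever. Being a condition at one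
  -- time, it persists under small changes of the initial point.
  have hh : Tendsto (fun t => ⟪ez, ez - (ξ t).2⟫ - c * ‖(ξ 0).1‖ * Real.exp (-β * t)) atTop
      (𝓝 1) := by
    have h1 := (tendsto_const_nhds (x := ez)).inner (𝕜 := ℝ) (hz.const_sub ez)
    have h2 := h1.sub ((tendsto_exp_neg_mul_atTop hβ).const_mul (c * ‖(ξ 0).1‖))
    simpa [hez] using h2
  obtain ⟨T, hT, hT0⟩ :=
    ((hh.eventually (lt_mem_nhds (zero_lt_one))).and (eventually_ge_atTop 0)).exists
  obtain ⟨C, hC0, hC⟩ := exists_dist_le_mul_of_trajectories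
    (contDiff_errorField (ez := ez) (α := α) (γ := γ)) (upsilon n ez)
    (max (M * (‖ξ 0‖ + 1)) 2) T
  -- The quantity, positive for `ξ` at `T`, changes by at most `(C + c) * dist q p < 1`; the entry
  -- `1` keeps `η` within the norm bound for which `C` was chosen.
  refine ⟨min 1 (1 / (C + c)), by positivity, fun q hq => ?_⟩
  obtain ⟨η, hη, hη0⟩ := exists_trajectory (α := α) (γ := γ) hez (q : State n) q.2
  refine ⟨η, hη, hη0, ?_⟩
  obtain ⟨hq1, hq2⟩ := lt_min_iff.1 (Metric.mem_ball.1 hq)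
  rw [lt_div_iff₀ (by positivity)] at hq2
  have hd : dist (η 0) (ξ 0) = dist q p := by rw [hη0, hξ0, Subtype.dist_eq]
  have hηn : ‖η 0‖ ≤ ‖ξ 0‖ + 1 := by
    have h1 := norm_sub_norm_le (η 0) (ξ 0)
    rw [← dist_eq_norm, hd] at h1
    linarith
  have hdist := hC η ξ hη hξ
    (fun t ht => (hη.norm_le_max hez hβ hM hdecay ht).trans
      (max_le_max (by gcongr) le_rfl))
    (fun t ht => (hξ.norm_le_max hez hβ hM hdecay ht).trans
      (max_le_max (by gcongr; linarith) le_rfl)) T ⟨hT0, le_rfl⟩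
  rw [hd] at hdist
  have h1 : ⟪ez, ez - (ξ T).2⟫ - ⟪ez, ez - (η T).2⟫ ≤ C * dist q p := by
    rw [← inner_sub_right]
    refine (real_inner_le_norm _ _).trans ?_
    rw [hez, one_mul, sub_sub_sub_cancel_left]
    refine le_trans ?_ hdist
    rw [dist_eq_norm]
    exact norm_snd_le (η T - ξ T)
  have h2 : ‖(η 0).1‖ ≤ ‖(ξ 0).1‖ + dist q p := by
    have h3 := norm_sub_norm_le (η 0).1 (ξ 0).1
    have h4 : ‖(η 0).1 - (ξ 0).1‖ ≤ dist q p := by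
      rw [← hd, dist_eq_norm]
      exact norm_fst_le (η 0 - ξ 0)
    linarith
  have h3 : c * ‖(η 0).1‖ * Real.exp (-β * T)
      ≤ c * ‖(ξ 0).1‖ * Real.exp (-β * T) + c * dist q p := by
    have h5 : Real.exp (-β * T) ≤ 1 := Real.exp_le_one_iff.2 (by nlinarith)
    calc c * ‖(η 0).1‖ * Real.exp (-β * T)
        ≤ c * (‖(ξ 0).1‖ + dist q p) * Real.exp (-β * T) := by gcongr
      _ = c * ‖(ξ 0).1‖ * Real.exp (-β * T) + c * dist q p * Real.exp (-β * T) := by ring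
      _ ≤ _ := by
        exact add_le_add le_rfl (mul_le_of_le_one_right (by positivity) h5)
  have hcrit : -1 < ⟪ez, ez - (η T).2⟫ - c * ‖(η 0).1‖ * Real.exp (-β * T) := by
    nlinarith
  refine (hη.tendsto_or hez hγ hβ hdecay).resolve_right fun h => ?_
  have hz' : Tendsto (fun t => (η t).2) atTop (𝓝 ((2 : ℝ) • ez)) :=
    (continuous_snd.tendsto _).comp h
  have h6 : Tendsto (fun t => ⟪ez, ez - (η t).2⟫) atTop (𝓝 (-1)) := by
    have h7 := (tendsto_const_nhds (x := ez)).inner (𝕜 := ℝ) (hz'.const_sub ez)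
    have h8 : ez - (2 : ℝ) • ez = -ez := by module
    simpa [h8, hez] using h7
  have h9 := ge_of_tendsto h6 (by
    filter_upwards [eventually_ge_atTop T] with t ht
    exact hη.le_inner hez hγ hβ hdecay hT0 ht)
  linarith

/-- A connected set with more than one point has no isolated points. -/
lemma exists_ne_mem_shiftedSphere (hez : ‖ez‖ = 1) {z : E3} (hz : ‖ez - z‖ = 1) {ε : ℝ}
    (hε : 0 < ε) : ∃ w : E3, ‖ez - w‖ = 1 ∧ w ≠ z ∧ dist w z < ε := by
  have hrank : 1 < Module.rank ℝ E3 := by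
    rw [← Module.finrank_eq_rank, finrank_euclideanSpace_fin]
    norm_num
  have hnt : (Metric.sphere (0 : E3) 1).Nontrivial := by
    refine ⟨ez, by simpa using hez, -ez, by simpa using hez, fun h => ?_⟩
    have h1 : (2 : ℝ) • ez = 0 := by rw [two_smul]; nth_rewrite 1 [h]; exact neg_add_cancel ez
    rw [(smul_eq_zero.1 h1).resolve_left two_ne_zero, norm_zero] at hez
    exact zero_ne_one hez
  have hacc := (isPreconnected_sphere hrank (0 : E3) 1).preperfect_of_nontrivial hnt (ez - z)
    (by simpa using hz)
  obtain ⟨y, ⟨hy1, hy2⟩, hy3⟩ := accPt_iff_nhds.1 hacc _ (Metric.ball_mem_nhds _ hε)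
  refine ⟨ez - y, by simpa using hy2, fun h => hy3 (by rw [← h]; abel), ?_⟩
  rw [Metric.mem_ball, dist_eq_norm] at hy1
  rw [dist_eq_norm]
  rwa [show ez - y - z = -(y - (ez - z)) by abel, norm_neg]

/-- For each initial value of the chain, at most one trajectory converges to `2 e_z`. -/
lemma IsTrajectory.eq_of_tendsto_two_smul (hez : ‖ez‖ = 1) (hγ : 0 < γ) (hβ : 0 < β)
    (hM : 0 ≤ M) (hdecay : ChainDecay α β M) {ξ η : ℝ → State n}
    (hξ : IsTrajectory (errorField ez α γ) (upsilon n ez) ξ)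
    (hη : IsTrajectory (errorField ez α γ) (upsilon n ez) η) (h0 : (ξ 0).1 = (η 0).1)
    (hξl : Tendsto ξ atTop (𝓝 (0, (2 : ℝ) • ez))) (hηl : Tendsto η atTop (𝓝 (0, (2 : ℝ) • ez))) :
    (ξ 0).2 = (η 0).2 := by
  have hfst : ∀ t : ℝ, 0 ≤ t → (ξ t).1 = (η t).1 := by
    intro t ht
    have := hdecay _ (hξ.isChainSolution.sub hη.isChainSolution) t ht
    simp only [h0, sub_self, norm_zero, mul_zero, zero_mul] at this
    exact sub_eq_zero.1 (norm_le_zero_iff.1 this)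
  have hlim : ∀ {ζ : ℝ → State n}, Tendsto ζ atTop (𝓝 (0, (2 : ℝ) • ez)) →
      Tendsto (fun t => ez - (ζ t).2) atTop (𝓝 (-ez)) := by
    intro ζ hζ
    have h8 : ez - (2 : ℝ) • ez = -ez := by module
    have := ((continuous_snd.tendsto _).comp hζ).const_sub ez
    rwa [h8] at this
  have hηs : IsSphereSolution γ (fun t => ez - (ξ t).1 0) (fun t => ez - (η t).2) := by
    intro t ht
    have := hη.isSphereSolution t ht
    simpa only [hfst t ht] using this
  have hu : Tendsto (fun t => ez - (ξ t).1 0) atTop (𝓝 ez) := by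
    have := (((continuous_apply 0).tendsto _).comp (hξ.tendsto_fst hβ hdecay)).const_sub ez
    simpa using this
  have h := hξ.isSphereSolution.eq_of_tendsto_neg hγ hez hηs (B := 1 + M * ‖(ξ 0).1‖)
    (fun t ht => by
      refine (norm_sub_le _ _).trans ?_
      rw [hez]
      gcongr
      refine (hdecay.norm_zero_le hξ.isChainSolution t ht).trans
        (mul_le_of_le_one_right (by positivity) (Real.exp_le_one_iff.2 (by nlinarith))))
    hu (hlim hξl) (hlim hηl)
  exact sub_right_injective h

lemma dense_basin (hez : ‖ez‖ = 1) (hγ : 0 < γ) (hβ : 0 < β) (hM : 0 ≤ M)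
    (hdecay : ChainDecay α β M) : Dense (basin ez α γ) := by
  intro p
  rw [Metric.mem_closure_iff]
  intro ε hε
  obtain ⟨ξ, hξ, hξ0⟩ := exists_trajectory (α := α) (γ := γ) hez (p : State n) p.2
  rcases hξ.tendsto_or hez hγ hβ hdecay with hlim | hlim
  · exact ⟨p, ⟨ξ, hξ, hξ0, hlim⟩, by simpa using hε⟩
  -- Only `z₂` is moved: with the chain unchanged, a second trajectory tending to `2 e_z` is
  -- impossible.
  obtain ⟨w, hw1, hw2, hw3⟩ := exists_ne_mem_shiftedSphere hez (mem_upsilon.1 p.2) hε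
  obtain ⟨η, hη, hη0⟩ := exists_trajectory (α := α) (γ := γ) hez ((p : State n).1, w)
    (mem_upsilon.2 hw1)
  refine ⟨⟨((p : State n).1, w), mem_upsilon.2 hw1⟩, ⟨η, hη, hη0, ?_⟩, ?_⟩
  · refine (hη.tendsto_or hez hγ hβ hdecay).resolve_right fun h => hw2 ?_
    have := hη.eq_of_tendsto_two_smul hez hγ hβ hM hdecay hξ (by rw [hη0, hξ0]) h hlim
    rwa [hη0, hξ0] at this
  · rw [Subtype.dist_eq, Prod.dist_eq, dist_comm _ w, dist_self]
    exact max_lt hε hw3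

lemma isAlmostGloballyAsymptoticallyStable_errorField (hez : ‖ez‖ = 1) (hα : ∀ i, 0 < α i)
    (hγ : 0 < γ) (hβ : 0 < β) (hM : 0 ≤ M) (hdecay : ChainDecay α β M) :
    IsAlmostGloballyAsymptoticallyStable (errorField ez α γ) (upsilon n ez) (0, 0) := by
  have h0 : ((0 : Fin n → E3), (0 : E3)) ∈ {ξ ∈ upsilon n ez | errorField ez α γ ξ = 0} := by
    rw [equilibria_eq hez hα hγ]
    exact mem_insert _ _
  refine ⟨h0.1, h0.2, isLyapunovStable_errorField hez hγ hβ hM hdecay, basin ez α γ,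
    isOpen_basin hez hγ hβ hM hdecay, dense_basin hez hγ hβ hM hdecay, ?_⟩
  -- `basin` supplies one convergent trajectory; uniqueness transfers the limit to every trajectory
  -- from the same point.
  rintro ξ hξ ⟨p, ⟨η, hη, hη0, hlim⟩, hp⟩
  refine hlim.congr' ?_
  filter_upwards [eventually_ge_atTop 0] with t ht
  exact hη.eqOn_Ici contDiff_errorField hξ (hη0.trans hp) ht

lemma exists_gains_convergesExponentiallyFrom (hez : ‖ez‖ = 1) {K : Set (State n)}
    (hK : K ⊆ upsilonStar n ez) (hKc : IsCompact K) {ρ : ℝ} (hρ : 0 < ρ) :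
    ∃ (α : Fin n → ℝ) (γ : ℝ), AdmissibleGains α γ ∧
      ConvergesExponentiallyFrom (errorField ez α γ) (upsilon n ez) K (0, 0) ρ := by
  rcases K.eq_empty_or_nonempty with rfl | hne
  · exact ⟨_, 1, admissibleGains_scaledGains_binomialGains one_pos one_pos, 1, one_pos,
      fun _ _ h => h.elim⟩
  obtain ⟨ξ₀, hξ₀, hmin⟩ := hKc.exists_isMinOn (f := fun ξ : State n => 1 + ⟪ez, ez - ξ.2⟫) hne
    (by fun_prop)
  obtain ⟨δ, hδ0, hδ⟩ : ∃ δ : ℝ, 0 < δ ∧ ∀ ξ ∈ K, δ ≤ 1 + ⟪ez, ez - ξ.2⟫ :=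
    ⟨_, one_add_inner_pos_of_mem_upsilonStar hez (hK hξ₀), fun ξ hξ => hmin hξ⟩
  obtain ⟨R, hR0, hR⟩ := hKc.isBounded.exists_pos_norm_le
  obtain ⟨β, M, hβ, hM, hdecay⟩ := exists_decay_of_isHurwitz
    (scaledGains_one (binomialGains n) ▸ isHurwitz_scaledGains_binomialGains one_pos)
  -- The height will be kept with margin `δ / 2`, and `2 ρ ≤ γ (δ / 2) / 2` then holds with
  -- equality.
  set γ := 8 * ρ / δ with hγdef
  have hγ : 0 < γ := by positivity
  -- `β` and `M` belong to the unscaled gains, so `k` can be chosen last: the second summand makes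
  -- the loss of height at most `δ / 2`, the third makes the chain faster than `ρ`, and the `1`
  -- gives `1 ≤ k`.
  set k := 1 + 2 * γ * M * R / (β * δ) + (ρ + 1) / β with hk
  have hk1 : 1 ≤ k := by
    have h1 : 0 ≤ 2 * γ * M * R / (β * δ) := by positivity
    have h2 : 0 ≤ (ρ + 1) / β := by positivity
    linarith
  have hk0 : 0 < k := by linarith
  have hβk : β * k = β + 2 * γ * M * R / δ + (ρ + 1) := by
    rw [hk]; field_simp
  have hMR : 0 ≤ 2 * γ * M * R / δ := by positivity
  have hρk : ρ < β * k := by linarith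
  have hρk' : 0 < β * k - ρ := by linarith
  have hpeak : γ * M * R / (β * k) ≤ δ / 2 := by
    rw [div_le_iff₀ (by positivity), hβk]
    have : δ / 2 * (2 * γ * M * R / δ) = γ * M * R := by field_simp
    nlinarith
  refine ⟨scaledGains (binomialGains n) k, γ, admissibleGains_scaledGains_binomialGains hk0 hγ,
    k ^ n * M + (1 + γ * M ^ 2 / (δ / 2 * (β * k - ρ))), by positivity,
    fun ξ hξ h0 t ht => ?_⟩
  simp only [Prod.mk_zero_zero, sub_zero]
  have hψ := fun t ht i => hξ.isChainSolution.norm_le_rescale hk1 hM hdecay (t := t) ht i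
  have hu : ∀ t : ℝ, 0 ≤ t → ‖(ξ t).1 0‖ ≤ M * ‖(ξ 0).1‖ * Real.exp (-(β * k) * t) := by
    intro t ht
    simpa using hψ t ht 0
  refine hξ.norm_le (M' := k ^ n * M) (β := β * k) hez hγ (by positivity) (fun s hs => ?_) hu
    (half_pos hδ0) (fun s hs => ?_) (by rw [hγdef]; field_simp; norm_num) hρk ht
  · rw [pi_norm_le_iff_of_nonneg (by positivity)]
    intro i
    refine (hψ s hs i).trans ?_
    rw [mul_assoc (k ^ n * M), mul_assoc (k ^ n), mul_assoc M]
    exact mul_le_mul_of_nonneg_right (pow_le_pow_right₀ hk1 i.2.le) (by positivity)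
  · have h1 := hξ.isSphereSolution.le_inner hγ (by positivity) hez hu le_rfl hs
    simp only [mul_zero, Real.exp_zero, mul_one] at h1
    have h2 : γ * (M * ‖(ξ 0).1‖) / (β * k) ≤ γ * M * R / (β * k) := by
      rw [← mul_assoc]
      gcongr
      exact (norm_fst_le _).trans (hR _ h0)
    have h3 := hδ _ h0
    linarith

end Stability

end TiltObserver

theorem theorem2 (n : ℕ) [NeZero n] (hn : 2 ≤ n) (ez : TiltObserver.E3) (hez : ‖ez‖ = 1) :
    (∀ (α : Fin n → ℝ) (γ : ℝ), TiltObserver.AdmissibleGains α γ →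
      TiltObserver.IsStateSpace (TiltObserver.errorField ez α γ) (TiltObserver.upsilon n ez) ∧
      {ξ ∈ TiltObserver.upsilon n ez | TiltObserver.errorField ez α γ ξ = 0} =
        {((0 : Fin n → TiltObserver.E3), (0 : TiltObserver.E3)), (0, (2 : ℝ) • ez)} ∧
      (∀ ξ : ℝ → TiltObserver.State n,
        TiltObserver.IsTrajectory (TiltObserver.errorField ez α γ)
          (TiltObserver.upsilon n ez) ξ →
        Tendsto ξ atTop (𝓝 (0, 0)) ∨ Tendsto ξ atTop (𝓝 (0, (2 : ℝ) • ez))) ∧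
      TiltObserver.IsAlmostGloballyAsymptoticallyStable (TiltObserver.errorField ez α γ)
        (TiltObserver.upsilon n ez) (0, 0) ∧
      TiltObserver.IsLocallyExponentiallyStable (TiltObserver.errorField ez α γ)
        (TiltObserver.upsilon n ez) (0, 0)) ∧
    (∀ K : Set (TiltObserver.State n), K ⊆ TiltObserver.upsilonStar n ez → IsCompact K →
      ∀ ρ : ℝ, 0 < ρ →
        ∃ (α : Fin n → ℝ) (γ : ℝ), TiltObserver.AdmissibleGains α γ ∧
          TiltObserver.ConvergesExponentiallyFrom (TiltObserver.errorField ez α γ)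
            (TiltObserver.upsilon n ez) K (0, 0) ρ) := by
  refine ⟨fun α γ hαγ => ?_, fun K hK hKc ρ hρ =>
    TiltObserver.exists_gains_convergesExponentiallyFrom hez hK hKc hρ⟩
  obtain ⟨hα, hH, hγ⟩ := hαγ
  obtain ⟨β, M, hβ, hM, hdecay⟩ := TiltObserver.exists_decay_of_isHurwitz hH
  exact ⟨TiltObserver.isStateSpace_of_exists_trajectory TiltObserver.contDiff_errorField
      (TiltObserver.exists_trajectory hez),
    TiltObserver.equilibria_eq hez hα hγ,
    fun ξ hξ => hξ.tendsto_or hez hγ hβ hdecay,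
    TiltObserver.isAlmostGloballyAsymptoticallyStable_errorField hez hα hγ hβ hM hdecay,
    TiltObserver.isLocallyExponentiallyStable_errorField hez hγ hβ hM hdecay⟩
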